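/- **Theorem 4.12.** Everything is over $\mathbb{C}$. Let $\pi$ be a finitely generated nilpotent group, and let $\mathfrak{n}$ be its Malcev Lie algebra, i.e. the Lie algebra of primitive elements of the completed group algebra $\varprojlim_n \mathbb{C}[\pi]/I^n$, where $I$ is the augmentation ideal ($\mathfrak n$ is finite-dimensional). Let $A=\mathcal{C}^\bullet(\mathfrak{n})=(\bigwedge^\bullet \mathfrak{n}^*,d)$ be its Chevalley–Eilenberg cochain algebra, where $d$ on $\mathfrak n^*$ is minus the dual of the Lie bracket. Let $\mathfrak{g}=\mathfrak{sl}_2$, or $\mathfrak{g}=\mathfrak{sol}_2$, the standard Borel subalgebra of $\mathfrak{sl}_2$, and let $\theta\colon\mathfrak{g}\to\mathfrak{gl}(V)$ be a representation on a non-zero finite-dimensional vector space $V$. Put * $\mathcal{F}(A,\mathfrak{g})=\{\omega\in A^1\otimes\mathfrak{g} \mid \partial\omega+\tfrac12[\omega,\omega]=0\}$, where $\partial(\alpha\otimes x)=d\alpha\otimes x$ and $[\alpha\otimes x,\beta\otimes y]=\alpha\beta\otimes[x,y]$; * $\mathcal{F}^1(A,\mathfrak{g})=\{\eta\otimes g \mid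 \eta\in A^1,\ d\eta=0,\ g\in\mathfrak{g}\}$; * $\Pi(A,\theta)=\{\eta\otimes g \mid \eta\in A^1,\ d\eta=0,\ g\in\mathfrak{g},\ \det\theta(g)=0\}$; * for $k\ge 0$, $\mathcal{R}^k_1(A,\theta)=\{\omega\in\mathcal{F}(A,\mathfrak{g}) \mid \dim_{\mathbb C} H^k(A\otimes V,d_\omega)\ge 1\}$, where for $\omega=\sum_i\eta_i\otimes g_i$ one sets $d_\omega(\alpha\otimes v)=d\alpha\otimes v+\sum_i\eta_i\alpha\otimes\theta(g_i)v$. Then $\mathcal{F}(A,\mathfrak{g})=\mathcal{F}^1(A,\mathfrak{g})$, and for every integer $k\ge 0$ $$\mathcal{R}^k_1(A,\theta)=\begin{cases}\emptyset & \text{if } k>\dim\mathfrak{n},\\ \Pi(A,\theta)\neq\emptyset & \text{if } k\le\dim\mathfrak{n}.\end{cases}$$ -/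

import Mathlib

open scoped TensorProduct

attribute [local instance] LieRing.ofAssociativeRing

noncomputable section

namespace FlatConn

universe u v w

/-- A commutative differential graded algebra over `ℂ`. -/
structure CDGA where
  /-- the total space `⨁ A^i` -/
  carrier : Type u
  [ring : Ring carrier]
  [algebra : Algebra ℂ carrier]
  /-- the homogeneous components `A^i` -/
  deg : ℕ → Submodule ℂ carrier
  [graded : GradedAlgebra deg]
  /-- the differential -/
  d : carrier →ₗ[ℂ] carrier
  mul_comm' : ∀ (i j : ℕ) (a b : carrier), a ∈ deg i → b ∈ deg j → a * b = (-1) ^ (i * j) * (b * a)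
  d_mem : ∀ (i : ℕ) (a : carrier), a ∈ deg i → d a ∈ deg (i + 1)
  d_d : ∀ a : carrier, d (d a) = 0
  leibniz : ∀ (i : ℕ) (a b : carrier), a ∈ deg i → d (a * b) = d a * b + (-1) ^ i * (a * d b)

attribute [instance] CDGA.ring CDGA.algebra CDGA.graded


section FlatConnections

namespace CDGA

variable (A : CDGA.{u}) (𝔤 : Type v) [LieRing 𝔤] [LieAlgebra ℂ 𝔤]
variable {V : Type w} [AddCommGroup V] [Module ℂ V]

/-- The degree `i` part `A^i ⊗ W` of `A ⊗ W`. -/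
def tensorDeg (W : Type w) [AddCommGroup W] [Module ℂ W] (i : ℕ) :
    Submodule ℂ (A.carrier ⊗[ℂ] W) :=
  LinearMap.range ((A.deg i).subtype.rTensor W)

/-- The bracket `[α ⊗ x, β ⊗ y] = αβ ⊗ [x, y]` of the differential graded Lie algebra `A ⊗ 𝔤`. -/
def bracket : A.carrier ⊗[ℂ] 𝔤 →ₗ[ℂ] A.carrier ⊗[ℂ] 𝔤 →ₗ[ℂ] A.carrier ⊗[ℂ] 𝔤 :=
  TensorProduct.map₂ (LinearMap.mul ℂ A.carrier) (LieModule.toEnd ℂ 𝔤 𝔤).toLinearMap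

lemma bracket_tmul (a b : A.carrier) (x y : 𝔤) :
    A.bracket 𝔤 (a ⊗ₜ x) (b ⊗ₜ y) = (a * b) ⊗ₜ ⁅x, y⁆ := rfl

/-- The set `F(A, 𝔤)` of `𝔤`-valued flat connections on `A`: the solutions `ω ∈ A^1 ⊗ 𝔤` of the
Maurer–Cartan equation `∂ω + ½ [ω, ω] = 0`. -/
def flatConnections : Set (A.carrier ⊗[ℂ] 𝔤) :=
  {ω | ω ∈ A.tensorDeg 𝔤 1 ∧ A.d.rTensor 𝔤 ω + (1 / 2 : ℂ) • A.bracket 𝔤 ω ω = 0}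

/-- The cocycles `Z^1(A)`. For a connected `A`, where `A^0` consists of the multiples of `1`, this is
`H^1(A)`. -/
def Z1 : Submodule ℂ A.carrier := A.deg 1 ⊓ LinearMap.ker A.d

/-- The essentially rank one part `F^1(A, 𝔤) = {η ⊗ g | η ∈ H^1(A), g ∈ 𝔤}` of `F(A, 𝔤)`, for a
connected `A`. -/
def essRankOne : Set (A.carrier ⊗[ℂ] 𝔤) := {ω | ∃ η ∈ A.Z1, ∃ g : 𝔤, ω = η ⊗ₜ g}

variable {𝔤} (θ : 𝔤 →ₗ⁅ℂ⁆ Module.End ℂ V)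

/-- `Π(A, θ) = {η ⊗ g | η ∈ H^1(A), g ∈ 𝔤, det θ(g) = 0}`, for a connected `A` and a
finite-dimensional representation `θ`. -/
def detLocus : Set (A.carrier ⊗[ℂ] 𝔤) :=
  {ω | ∃ η ∈ A.Z1, ∃ g : 𝔤, LinearMap.det (θ g) = 0 ∧ ω = η ⊗ₜ g}

/-- The covariant derivative `d_ω (α ⊗ v) = dα ⊗ v + ∑ η_i α ⊗ θ(g_i) v` on `A ⊗ V`, for
`ω = ∑ η_i ⊗ g_i`. -/
def covDeriv (ω : A.carrier ⊗[ℂ] 𝔤) : A.carrier ⊗[ℂ] V →ₗ[ℂ] A.carrier ⊗[ℂ] V :=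
  A.d.rTensor V + TensorProduct.map₂ (LinearMap.mul ℂ A.carrier) θ.toLinearMap ω

lemma covDeriv_tmul (η α : A.carrier) (g : 𝔤) (v : V) :
    A.covDeriv θ (η ⊗ₜ g) (α ⊗ₜ v) = A.d α ⊗ₜ v + (η * α) ⊗ₜ θ g v := rfl

/-- The degree `k` cocycles of the Aomoto complex `(A ⊗ V, d_ω)`. -/
def aomotoCocycles (ω : A.carrier ⊗[ℂ] 𝔤) (k : ℕ) : Submodule ℂ (A.carrier ⊗[ℂ] V) :=
  A.tensorDeg V k ⊓ LinearMap.ker (A.covDeriv θ ω)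

/-- The degree `k` coboundaries of the Aomoto complex `(A ⊗ V, d_ω)`. -/
def aomotoCoboundaries (ω : A.carrier ⊗[ℂ] 𝔤) : ℕ → Submodule ℂ (A.carrier ⊗[ℂ] V)
  | 0 => ⊥
  | k + 1 => (A.tensorDeg V k).map (A.covDeriv θ ω)

/-- The cohomology `H^k(A ⊗ V, d_ω)` of the Aomoto complex. -/
abbrev aomotoCohomology (ω : A.carrier ⊗[ℂ] 𝔤) (k : ℕ) : Type _ :=
  A.aomotoCocycles θ ω k ⧸ (A.aomotoCoboundaries θ ω k).submoduleOf (A.aomotoCocycles θ ω k)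

/-- The resonance variety `R^k_r(A, θ) = {ω ∈ F(A, 𝔤) | dim H^k(A ⊗ V, d_ω) ≥ r}`. -/
def resonance (k r : ℕ) : Set (A.carrier ⊗[ℂ] 𝔤) :=
  {ω | ω ∈ A.flatConnections 𝔤 ∧ (r : Cardinal) ≤ Module.rank ℂ (A.aomotoCohomology θ ω k)}

end CDGA

end FlatConnections

/-- `𝔰𝔬𝔩₂`, the standard Borel subalgebra of `𝔰𝔩₂`: the traceless upper triangular matrices. -/
def sol2 : LieSubalgebra ℂ (Matrix (Fin 2) (Fin 2) ℂ) where
  carrier := {a | a.trace = 0 ∧ a 1 0 = 0}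
  add_mem' {a b} ha hb := by
    rw [Set.mem_ofPred_eq] at *
    simp [Matrix.trace_add, ha.1, ha.2, hb.1, hb.2]
  zero_mem' := by simp
  smul_mem' c a ha := by
    rw [Set.mem_ofPred_eq] at *
    simp [Matrix.trace_smul, ha.1, ha.2]
  lie_mem' {a b} ha hb := by
    obtain ⟨ha, ha'⟩ := ha
    obtain ⟨hb, hb'⟩ := hb
    refine ⟨LieAlgebra.matrix_trace_commutator_zero _ _ _ _, ?_⟩
    rw [Matrix.trace_fin_two] at ha hb
    simp [Ring.lie_def, Matrix.mul_apply, Fin.sum_univ_two, ha', hb']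

section ExteriorAlgebra

variable {M : Type u} [AddCommGroup M] [Module ℂ M]

open ExteriorAlgebra

lemma ι_mul_ι_comm (f g : M) : ι ℂ f * ι ℂ g = -(ι ℂ g * ι ℂ f) :=
  eq_neg_of_add_eq_zero_left (ι_add_mul_swap f g)

/-- The grade involution, `a ↦ (-1)^i a` for `a` of degree `i`. -/
abbrev bar : ExteriorAlgebra ℂ M →ₐ[ℂ] ExteriorAlgebra ℂ M :=
  CliffordAlgebra.involute

lemma bar_ι (f : M) : bar (ι ℂ f) = -ι ℂ f :=
  CliffordAlgebra.involute_ι f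

lemma bar_of_mem (i : ℕ) (a : ExteriorAlgebra ℂ M)
    (ha : a ∈ ⋀[ℂ]^i M) : bar a = (-1) ^ i * a := by
  induction ha using Submodule.pow_induction_on_left' with
  | algebraMap r => simp
  | add a b i _ _ h h' => rw [map_add, h, h', mul_add]
  | mem_mul m hm i a _ h =>
    obtain ⟨f, rfl⟩ := hm
    rw [map_mul, h, bar_ι, pow_succ']
    rcases neg_one_pow_eq_or (ExteriorAlgebra ℂ M) i with h | h <;> simp [h]

lemma ext_mul_comm (i j : ℕ) (a b : ExteriorAlgebra ℂ M)
    (ha : a ∈ ⋀[ℂ]^i M) (hb : b ∈ ⋀[ℂ]^j M) :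
    a * b = (-1) ^ (i * j) * (b * a) := by
  have key : ∀ f : M, ι ℂ f * b = (-1) ^ j * (b * ι ℂ f) := by
    intro f
    induction hb using Submodule.pow_induction_on_left' with
    | algebraMap r => simpa using (Algebra.commutes r _).symm
    | add a b i _ _ h h' => rw [mul_add, h, h', ← mul_add, ← add_mul]
    | mem_mul m hm i a ha h =>
      obtain ⟨g, rfl⟩ := hm
      rw [← mul_assoc, ι_mul_ι_comm, neg_mul, mul_assoc, h, pow_succ]
      rcases neg_one_pow_eq_or (ExteriorAlgebra ℂ M) i with h | h <;>
        simp [h, mul_assoc]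
  induction ha using Submodule.pow_induction_on_left' with
  | algebraMap r => simpa using Algebra.commutes r b
  | add a a' i _ _ h h' => rw [add_mul, h, h', ← mul_add, ← mul_add]
  | mem_mul m hm i a _ h =>
    obtain ⟨f, rfl⟩ := hm
    rw [mul_assoc, h, Nat.succ_mul, pow_add]
    rcases neg_one_pow_eq_or (ExteriorAlgebra ℂ M) (i * j) with h | h <;>
      simp [h, ← mul_assoc, key] 

end ExteriorAlgebra

section ChevalleyEilenberg

variable (n : Type u) [LieRing n] [LieAlgebra ℂ n] [Module.Finite ℂ n]

open ExteriorAlgebra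

/-- The map `𝔫* → ⋀ 𝔫*`, `f ↦ - ½ ∑ f([b i, b j]) b i* ∧ b j*`, i.e.
`- ∑_{i < j} f([b i, b j]) b i* ∧ b j*`: minus the dual of the Lie bracket. -/
def bracketDual : Module.Dual ℂ n →ₗ[ℂ] ExteriorAlgebra ℂ (Module.Dual ℂ n) :=
  let b := Module.finBasis ℂ n
  (-(1 / 2 : ℂ)) • ∑ i, ∑ j, (LinearMap.toSpanSingleton ℂ _
    (ι ℂ (b.coord i) * ι ℂ (b.coord j))).comp (Module.Dual.eval ℂ n ⁅b i, b j⁆)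

lemma bracketDual_apply (f : Module.Dual ℂ n) : bracketDual n f =
    (-(1 / 2 : ℂ)) • ∑ i, ∑ j, f ⁅Module.finBasis ℂ n i, Module.finBasis ℂ n j⁆ •
      (ι ℂ ((Module.finBasis ℂ n).coord i) * ι ℂ ((Module.finBasis ℂ n).coord j)) := by
  simp [bracketDual]

/-- `bracketDual` may be computed in any basis. -/
lemma bracketDual_eq {κ : Type*} [Fintype κ] (c : Module.Basis κ ℂ n) (f : Module.Dual ℂ n) :
    bracketDual n f = (-(1 / 2 : ℂ)) • ∑ i, ∑ j, f ⁅c i, c j⁆ •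
      (ι ℂ (c.coord i) * ι ℂ (c.coord j)) := by
  classical
  set b := Module.finBasis ℂ n with hb
  have hcoord : ∀ i, b.coord i = ∑ k, b.repr (c k) i • c.coord k := by
    intro i
    refine c.ext fun k => ?_
    simp [Module.Basis.coord_apply, Finsupp.single_apply]
  have hsum : ∀ k, c k = ∑ i, b.repr (c k) i • b i := fun k => (b.sum_repr (c k)).symm
  have h1 : ∀ i j, f ⁅b i, b j⁆ • (ι ℂ (b.coord i) * ι ℂ (b.coord j)) =
      ∑ k, ∑ l, (b.repr (c k) i * b.repr (c l) j * f ⁅b i, b j⁆) •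
        (ι ℂ (c.coord k) * ι ℂ (c.coord l)) := by
    intro i j
    rw [hcoord i, hcoord j, map_sum, map_sum, Finset.sum_mul_sum, Finset.smul_sum]
    refine Finset.sum_congr rfl fun k _ => ?_
    rw [Finset.smul_sum]
    refine Finset.sum_congr rfl fun l _ => ?_
    rw [map_smul, map_smul, smul_mul_smul_comm, smul_smul, mul_comm]
  have h2 : ∀ k l, f ⁅c k, c l⁆ = ∑ i, ∑ j, b.repr (c k) i * b.repr (c l) j * f ⁅b i, b j⁆ := by
    intro k l
    conv_lhs => rw [hsum k, hsum l]
    simp only [sum_lie, map_sum]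
    refine Finset.sum_congr rfl fun i _ => ?_
    simp only [lie_sum, map_sum]
    refine Finset.sum_congr rfl fun j _ => ?_
    rw [smul_lie, lie_smul, map_smul, map_smul, smul_eq_mul, smul_eq_mul, mul_assoc]
  rw [bracketDual_apply, ← hb]
  congr 1
  simp only [h1, h2, Finset.sum_smul]
  calc _ = ∑ i, ∑ k, ∑ j, ∑ l, (b.repr (c k) i * b.repr (c l) j * f ⁅b i, b j⁆) •
        (ι ℂ (c.coord k) * ι ℂ (c.coord l)) := Finset.sum_congr rfl fun i _ => Finset.sum_comm
    _ = ∑ k, ∑ i, ∑ j, ∑ l, (b.repr (c k) i * b.repr (c l) j * f ⁅b i, b j⁆) •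
        (ι ℂ (c.coord k) * ι ℂ (c.coord l)) := Finset.sum_comm
    _ = ∑ k, ∑ i, ∑ l, ∑ j, (b.repr (c k) i * b.repr (c l) j * f ⁅b i, b j⁆) •
        (ι ℂ (c.coord k) * ι ℂ (c.coord l)) :=
      Finset.sum_congr rfl fun k _ => Finset.sum_congr rfl fun i _ => Finset.sum_comm
    _ = _ := Finset.sum_congr rfl fun k _ => Finset.sum_comm

lemma bracketDual_commute (f g : Module.Dual ℂ n) :
    bracketDual n f * ι ℂ g = ι ℂ g * bracketDual n f := by
  simp only [bracketDual_apply, smul_mul_assoc, mul_smul_comm, Finset.sum_mul, Finset.mul_sum]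
  congr 1
  refine Finset.sum_congr rfl fun i _ => Finset.sum_congr rfl fun j _ => ?_
  rw [mul_assoc, ι_mul_ι_comm _ g, mul_neg, ← mul_assoc, ι_mul_ι_comm _ g, neg_mul, neg_neg,
    mul_assoc]

/-- The algebra map `a ↦ !![ā, d a; 0, a]` that encodes the extension of `bracketDual` to an
antiderivation `d`; here `ā = (-1)^i a` for `a` of degree `i`. -/
def liftMatrix : ExteriorAlgebra ℂ (Module.Dual ℂ n) →ₐ[ℂ]
    Matrix (Fin 2) (Fin 2) (ExteriorAlgebra ℂ (Module.Dual ℂ n)) :=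
  ExteriorAlgebra.lift ℂ ⟨
    { toFun f := !![-ι ℂ f, bracketDual n f; 0, ι ℂ f]
      map_add' f g := by ext i j; fin_cases i <;> fin_cases j <;> simp [add_comm]
      map_smul' c f := by ext i j; fin_cases i <;> fin_cases j <;> simp }, fun f => by
    simp [bracketDual_commute, ← Matrix.ext_iff, Fin.forall_fin_two]⟩

/-- The Chevalley–Eilenberg differential of `⋀ 𝔫*`. -/
def ceD : ExteriorAlgebra ℂ (Module.Dual ℂ n) →ₗ[ℂ] ExteriorAlgebra ℂ (Module.Dual ℂ n) :=
  (Matrix.entryLinearMap ℂ _ 0 1).comp (liftMatrix n).toLinearMap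

lemma liftMatrix_apply (a : ExteriorAlgebra ℂ (Module.Dual ℂ n)) :
    liftMatrix n a = !![bar a, ceD n a; 0, a] := by
  have h : liftMatrix n a 0 0 = bar a ∧ liftMatrix n a 1 0 = 0 ∧ liftMatrix n a 1 1 = a := by
    induction a using ExteriorAlgebra.induction with
    | algebraMap r => simp [Matrix.algebraMap_matrix_apply]
    | ι f => simp [liftMatrix]
    | mul a b ha hb =>
      obtain ⟨ha1, ha2, ha3⟩ := ha
      obtain ⟨hb1, hb2, hb3⟩ := hb
      simp [Matrix.mul_apply, Fin.sum_univ_two, *]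
    | add a b ha hb =>
      obtain ⟨ha1, ha2, ha3⟩ := ha
      obtain ⟨hb1, hb2, hb3⟩ := hb
      simp [*]
  ext i j
  fin_cases i <;> fin_cases j
  · exact h.1
  · rfl
  · exact h.2.1
  · exact h.2.2

lemma ceD_algebraMap (r : ℂ) : ceD n (algebraMap ℂ _ r) = 0 := by
  simp [ceD, Matrix.algebraMap_matrix_apply]

lemma ceD_ι (f : Module.Dual ℂ n) : ceD n (ι ℂ f) = bracketDual n f := by
  simp [ceD, liftMatrix]

lemma ceD_mul (a b : ExteriorAlgebra ℂ (Module.Dual ℂ n)) :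
    ceD n (a * b) = ceD n a * b + bar a * ceD n b := by
  have : ceD n (a * b) = (liftMatrix n a * liftMatrix n b) 0 1 := by
    rw [← map_mul]; rfl
  rw [this, liftMatrix_apply, liftMatrix_apply]
  simp [Matrix.mul_apply, Fin.sum_univ_two, add_comm]

lemma bar_bracketDual (f : Module.Dual ℂ n) : bar (bracketDual n f) = bracketDual n f := by
  simp [bracketDual_apply]

lemma ceD_bar (a : ExteriorAlgebra ℂ (Module.Dual ℂ n)) : ceD n (bar a) = -bar (ceD n a) := by
  induction a using ExteriorAlgebra.induction with
  | algebraMap r => simp [ceD_algebraMap]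
  | ι f => rw [bar_ι, map_neg, ceD_ι, bar_bracketDual]
  | mul a b ha hb =>
    simp only [map_mul, ceD_mul, ha, hb, map_add, CliffordAlgebra.involute_involute]
    simp [add_comm]
  | add a b ha hb => simp only [map_add, ha, hb, neg_add]

lemma ceD_bracketDual (f : Module.Dual ℂ n) : ceD n (bracketDual n f) = 0 := by
  set b := Module.finBasis ℂ n with hb
  set e : Fin (Module.finrank ℂ n) → ExteriorAlgebra ℂ (Module.Dual ℂ n) :=
    fun i => ι ℂ (b.coord i) with he
  have hanti : ∀ k l, e k * e l = -(e l * e k) := fun k l => ι_mul_ι_comm _ _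
  have hcyc : ∀ k l j, e k * e l * e j = e l * e j * e k := by
    intro k l j
    rw [hanti k l, neg_mul, mul_assoc, hanti k j, mul_neg, neg_neg, mul_assoc]
  set J : Fin (Module.finrank ℂ n) → Fin (Module.finrank ℂ n) → Fin (Module.finrank ℂ n) → ℂ :=
    fun k l j => f ⁅⁅b k, b l⁆, b j⁆ with hJ
  have hJac : ∀ k l j, J j k l + J l j k + J k l j = 0 := by
    intro k l j
    simp only [hJ]
    have h : ⁅⁅b j, b k⁆, b l⁆ + ⁅⁅b l, b j⁆, b k⁆ + ⁅⁅b k, b l⁆, b j⁆ =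
        -(⁅b k, ⁅b l, b j⁆⁆ + ⁅b l, ⁅b j, b k⁆⁆ + ⁅b j, ⁅b k, b l⁆⁆) := by
      rw [← lie_skew (b k) ⁅b l, b j⁆, ← lie_skew (b l) ⁅b j, b k⁆, ← lie_skew (b j) ⁅b k, b l⁆]
      abel
    rw [← map_add, ← map_add, h, lie_jacobi, neg_zero, map_zero]
  set T := ∑ k, ∑ l, ∑ j, J k l j • (e k * e l * e j) with hT
  have hrot : ∀ F : Fin (Module.finrank ℂ n) → Fin (Module.finrank ℂ n) →
      Fin (Module.finrank ℂ n) → ℂ, ∑ k, ∑ l, ∑ j, F k l j • (e k * e l * e j) =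
        ∑ k, ∑ l, ∑ j, F j k l • (e k * e l * e j) := by
    intro F
    calc _ = ∑ j, ∑ k, ∑ l, F j k l • (e k * e l * e j) :=
          Finset.sum_congr rfl fun j _ => Finset.sum_congr rfl fun k _ =>
            Finset.sum_congr rfl fun l _ => by rw [hcyc j k l]
      _ = ∑ k, ∑ j, ∑ l, F j k l • (e k * e l * e j) := Finset.sum_comm
      _ = ∑ k, ∑ l, ∑ j, F j k l • (e k * e l * e j) :=
        Finset.sum_congr rfl fun k _ => Finset.sum_comm
  have hT0 : T = 0 := by
    have h2 : T = ∑ k, ∑ l, ∑ j, J j k l • (e k * e l * e j) := hrot J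
    have h3 : T = ∑ k, ∑ l, ∑ j, J l j k • (e k * e l * e j) := h2.trans (hrot _)
    have h : T + T + T = 0 := by
      conv_lhs => enter [1, 1]; rw [h2]
      conv_lhs => enter [1, 2]; rw [h3]
      rw [hT]
      simp only [← Finset.sum_add_distrib, ← add_smul, hJac, zero_smul, Finset.sum_const_zero]
    have h' : (3 : ℂ) • T = 0 := by rw [← h]; module
    exact (smul_eq_zero.mp h').resolve_left (by norm_num)
  have hS : ∑ i, ∑ j, f ⁅b i, b j⁆ • (bracketDual n (b.coord i) * e j) = 0 := by
    have h1 : T = ∑ k, ∑ l, ∑ j, ∑ i, (f ⁅b i, b j⁆ * b.coord i ⁅b k, b l⁆) •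
        (e k * e l * e j) := by
      refine Finset.sum_congr rfl fun k _ => Finset.sum_congr rfl fun l _ =>
        Finset.sum_congr rfl fun j _ => ?_
      rw [← Finset.sum_smul]
      congr 1
      simp only [hJ]
      conv_lhs => rw [← b.sum_repr ⁅b k, b l⁆, sum_lie, map_sum]
      refine Finset.sum_congr rfl fun i _ => ?_
      rw [smul_lie, map_smul, smul_eq_mul, mul_comm, Module.Basis.coord_apply]
    have h2 : ∑ i, ∑ j, f ⁅b i, b j⁆ • (bracketDual n (b.coord i) * e j) =
        (-(1 / 2 : ℂ)) • ∑ i, ∑ j, ∑ k, ∑ l, (f ⁅b i, b j⁆ * b.coord i ⁅b k, b l⁆) •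
          (e k * e l * e j) := by
      simp only [bracketDual_apply, Finset.smul_sum, Finset.sum_mul, smul_mul_assoc]
      refine Finset.sum_congr rfl fun i _ => Finset.sum_congr rfl fun j _ =>
        Finset.sum_congr rfl fun k _ => Finset.sum_congr rfl fun l _ => ?_
      rw [smul_smul, smul_smul, smul_smul]
      congr 1
      ring
    rw [h2]
    convert smul_zero (-(1 / 2 : ℂ))
    rw [← hT0, h1]
    calc _ = ∑ i, ∑ k, ∑ j, ∑ l, (f ⁅b i, b j⁆ * b.coord i ⁅b k, b l⁆) •
          (e k * e l * e j) := Finset.sum_congr rfl fun i _ => Finset.sum_comm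
      _ = ∑ k, ∑ i, ∑ j, ∑ l, (f ⁅b i, b j⁆ * b.coord i ⁅b k, b l⁆) •
          (e k * e l * e j) := Finset.sum_comm
      _ = ∑ k, ∑ i, ∑ l, ∑ j, (f ⁅b i, b j⁆ * b.coord i ⁅b k, b l⁆) •
          (e k * e l * e j) :=
        Finset.sum_congr rfl fun k _ => Finset.sum_congr rfl fun i _ => Finset.sum_comm
      _ = ∑ k, ∑ l, ∑ i, ∑ j, (f ⁅b i, b j⁆ * b.coord i ⁅b k, b l⁆) •
          (e k * e l * e j) := Finset.sum_congr rfl fun k _ => Finset.sum_comm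
      _ = _ := Finset.sum_congr rfl fun k _ => Finset.sum_congr rfl fun l _ => Finset.sum_comm
  have hS' : ∑ i, ∑ j, f ⁅b i, b j⁆ • (e i * bracketDual n (b.coord j)) = 0 := by
    rw [Finset.sum_comm, ← neg_eq_zero, ← hS, ← Finset.sum_neg_distrib]
    refine Finset.sum_congr rfl fun j _ => ?_
    rw [← Finset.sum_neg_distrib]
    refine Finset.sum_congr rfl fun i _ => ?_
    rw [← lie_skew, map_neg, neg_smul, neg_neg, bracketDual_commute]
  rw [bracketDual_apply, ← hb, map_smul, map_sum]
  convert smul_zero (-(1 / 2 : ℂ))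
  simp only [map_sum, map_smul, ceD_mul, ceD_ι, bar_ι, smul_add, neg_mul, smul_neg,
    Finset.sum_add_distrib, Finset.sum_neg_distrib]
  change _ + -(∑ i, ∑ j, f ⁅b i, b j⁆ • (e i * bracketDual n (b.coord j))) = _
  rw [hS', neg_zero, add_zero]
  exact hS

lemma ceD_ceD (a : ExteriorAlgebra ℂ (Module.Dual ℂ n)) : ceD n (ceD n a) = 0 := by
  induction a using ExteriorAlgebra.induction with
  | algebraMap r => simp [ceD_algebraMap]
  | ι f => rw [ceD_ι, ceD_bracketDual]
  | mul a b ha hb =>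
    simp only [ceD_mul, map_add, ceD_bar, ha, hb]
    simp
  | add a b ha hb => simp only [map_add, ha, hb, add_zero]

lemma bracketDual_mem (f : Module.Dual ℂ n) : bracketDual n f ∈ ⋀[ℂ]^2 (Module.Dual ℂ n) := by
  rw [bracketDual_apply, exteriorPower, pow_two]
  exact Submodule.smul_mem _ _ (Submodule.sum_mem _ fun i _ => Submodule.sum_mem _ fun j _ =>
    Submodule.smul_mem _ _ (Submodule.mul_mem_mul ⟨_, rfl⟩ ⟨_, rfl⟩))

lemma ceD_mem (i : ℕ) (a : ExteriorAlgebra ℂ (Module.Dual ℂ n))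
    (ha : a ∈ ⋀[ℂ]^i (Module.Dual ℂ n)) : ceD n a ∈ ⋀[ℂ]^(i + 1) (Module.Dual ℂ n) := by
  induction ha using Submodule.pow_induction_on_left' with
  | algebraMap r => simp [ceD_algebraMap]
  | add a b i _ _ h h' => rw [map_add]; exact Submodule.add_mem _ h h'
  | mem_mul m hm i a ha h =>
    obtain ⟨f, rfl⟩ := hm
    rw [ceD_mul, ceD_ι, bar_ι]
    refine Submodule.add_mem _ ?_ ?_
    · have := SetLike.mul_mem_graded (A := fun i : ℕ => ⋀[ℂ]^i (Module.Dual ℂ n))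
        (bracketDual_mem n f) ha
      rwa [show 2 + i = i.succ + 1 by omega] at this
    · rw [neg_mul]
      refine Submodule.neg_mem _ ?_
      have := Submodule.mul_mem_mul (M := LinearMap.range (ι ℂ (M := Module.Dual ℂ n))) ⟨f, rfl⟩ h
      rwa [exteriorPower, ← pow_succ'] at this

/-- The cochain algebra `C(𝔫) = (⋀ 𝔫*, d)` of a finite-dimensional Lie algebra. -/
def cochainAlgebra : CDGA where
  carrier := ExteriorAlgebra ℂ (Module.Dual ℂ n)
  deg i := ⋀[ℂ]^i (Module.Dual ℂ n)
  d := ceD n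
  mul_comm' := ext_mul_comm
  d_mem := ceD_mem n
  d_d := ceD_ceD n
  leibniz i a b ha := by rw [ceD_mul, bar_of_mem i a ha, mul_assoc]

end ChevalleyEilenberg

section Malcev

variable (π : Type u) [Group π]

/-- The augmentation `ℂ[π] → ℂ`, `∑ c_g g ↦ ∑ c_g`. -/
def augmentation : MonoidAlgebra ℂ π →ₐ[ℂ] ℂ := MonoidAlgebra.lift ℂ ℂ π 1

/-- The augmentation ideal of the group algebra `ℂ[π]`. -/
abbrev augIdeal : Ideal (MonoidAlgebra ℂ π) := RingHom.ker (augmentation π)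

/-- The completed group algebra: the inverse limit of the algebras `ℂ[π] / I ^ n`, where `I` is the
augmentation ideal. -/
def CompletedGroupAlgebra : Subalgebra ℂ (∀ n : ℕ, MonoidAlgebra ℂ π ⧸ augIdeal π ^ n) where
  carrier := {x | ∀ (m n : ℕ) (h : m ≤ n),
    Ideal.Quotient.factorₐ ℂ (Ideal.pow_le_pow_right h) (x n) = x m}
  mul_mem' hx hy m n h := by simp only [Pi.mul_apply, map_mul, hx m n h, hy m n h]
  add_mem' hx hy m n h := by simp only [Pi.add_apply, map_add, hx m n h, hy m n h]
  algebraMap_mem' r m n h := by simp only [Pi.algebraMap_apply, AlgHom.commutes]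

variable {π} {π' : Type v} [Group π']

lemma augIdeal_le_comap (f : π →* π') :
    augIdeal π ≤ (augIdeal π').comap (MonoidAlgebra.mapDomainAlgHom ℂ ℂ f) := by
  intro x hx
  have h : (augmentation π').comp (MonoidAlgebra.mapDomainAlgHom ℂ ℂ f) = augmentation π := by
    ext; simp [augmentation]
  rw [Ideal.mem_comap, RingHom.mem_ker, ← hx, ← h]
  rfl

lemma augIdeal_pow_le_comap (f : π →* π') (n : ℕ) :
    augIdeal π ^ n ≤ (augIdeal π' ^ n).comap (MonoidAlgebra.mapDomainAlgHom ℂ ℂ f) := by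
  induction n with
  | zero => simp [Submodule.pow_zero, Ideal.one_eq_top]
  | succ n ih =>
    rw [Ideal.IsTwoSided.pow_succ, Ideal.IsTwoSided.pow_succ, Ideal.mul_le]
    intro a ha b hb
    rw [Ideal.mem_comap, map_mul]
    exact Ideal.mul_mem_mul (augIdeal_le_comap f ha) (ih hb)

/-- The algebra map `ℂ[π] / I ^ n → ℂ[π'] / I' ^ n` induced by a group homomorphism. -/
def quotientMap (f : π →* π') (n : ℕ) :
    (MonoidAlgebra ℂ π ⧸ augIdeal π ^ n) →ₐ[ℂ] (MonoidAlgebra ℂ π' ⧸ augIdeal π' ^ n) :=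
  Ideal.quotientMapₐ _ (MonoidAlgebra.mapDomainAlgHom ℂ ℂ f) (augIdeal_pow_le_comap f n)

/-- The map of completed group algebras induced by a group homomorphism. -/
def completedMap (f : π →* π') : CompletedGroupAlgebra π →ₐ[ℂ] CompletedGroupAlgebra π' :=
  ((AlgHom.pi fun n => (quotientMap f n).comp (Pi.evalAlgHom ℂ _ n)).comp
      (CompletedGroupAlgebra π).val).codRestrict (CompletedGroupAlgebra π') (by
    intro x m n h
    have hx := x.2 m n h
    change Ideal.Quotient.factorₐ ℂ _ (quotientMap f n (x.1 n)) = quotientMap f m (x.1 m)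
    rw [← hx]
    obtain ⟨a, ha⟩ := Ideal.Quotient.mk_surjective (x.1 n)
    rw [← ha]
    rfl)

lemma completedMap_inl_mul_inr (x y : CompletedGroupAlgebra π) :
    completedMap (MonoidHom.inl π π) x * completedMap (MonoidHom.inr π π) y =
      completedMap (MonoidHom.inr π π) y * completedMap (MonoidHom.inl π π) x := by
  have key : ∀ a b : MonoidAlgebra ℂ π,
      Commute (MonoidAlgebra.mapDomainAlgHom ℂ ℂ (MonoidHom.inl π π) a)
        (MonoidAlgebra.mapDomainAlgHom ℂ ℂ (MonoidHom.inr π π) b) := by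
    intro a b
    induction a using MonoidAlgebra.induction_linear with
    | zero => simp
    | add a a' h h' => rw [map_add]; exact h.add_left h'
    | single g r =>
      induction b using MonoidAlgebra.induction_linear with
      | zero => simp
      | add b b' h h' => rw [map_add]; exact h.add_right h'
      | single g' r' =>
        simp [Commute, SemiconjBy, MonoidAlgebra.single_mul_single, mul_comm r]
  apply Subtype.ext
  funext n
  change quotientMap _ n (x.1 n) * quotientMap _ n (y.1 n) =
    quotientMap _ n (y.1 n) * quotientMap _ n (x.1 n)
  obtain ⟨a, ha⟩ := Ideal.Quotient.mk_surjective (x.1 n)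
  obtain ⟨b, hb⟩ := Ideal.Quotient.mk_surjective (y.1 n)
  rw [← ha, ← hb]
  exact congrArg (Ideal.Quotient.mk (augIdeal (π × π) ^ n)) (key a b)

variable (π)

/-- The complex Malcev Lie algebra of a group: the primitive elements of the completed group algebra,
with the commutator bracket. The completion of `ℂ[π × π]` plays the role of the completed tensor
square, so that `x ↦ Δ x` is induced by the diagonal `π → π × π`, and `x ↦ x ⊗ 1`, `x ↦ 1 ⊗ x` by the
two inclusions; `x` is primitive if `Δ x = x ⊗ 1 + 1 ⊗ x`. -/
def malcevSubalgebra : LieSubalgebra ℂ (CompletedGroupAlgebra π) where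
  carrier := {x | completedMap ((MonoidHom.id π).prod (MonoidHom.id π)) x =
    completedMap (MonoidHom.inl π π) x + completedMap (MonoidHom.inr π π) x}
  add_mem' {x y} hx hy := by
    simp only [Set.mem_ofPred_eq, map_add] at *
    rw [hx, hy]; abel
  zero_mem' := by simp
  smul_mem' c x hx := by
    simp only [Set.mem_ofPred_eq, map_smul] at *
    rw [hx, smul_add]
  lie_mem' {x y} hx hy := by
    change completedMap _ _ = _ at hx
    change completedMap _ _ = _ at hy
    change completedMap _ _ = _
    simp only [LieRing.of_associative_ring_bracket, map_sub, map_mul, hx, hy, mul_add, add_mul,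
      completedMap_inl_mul_inr]
    abel

/-- The complex Malcev Lie algebra of a group, as a Lie algebra in its own right. -/
def MalcevLieAlgebra : Type u := malcevSubalgebra π

instance : LieRing (MalcevLieAlgebra π) := inferInstanceAs (LieRing (malcevSubalgebra π))

instance : LieAlgebra ℂ (MalcevLieAlgebra π) := inferInstanceAs (LieAlgebra ℂ (malcevSubalgebra π))

end Malcev

end FlatConn

end

noncomputable section

namespace FlatConn

/-! ### Powers of the augmentation ideal and the lower central series. -/

section AugmentationPowers

open MonoidAlgebra
open scoped commutatorElement

variable {π : Type*} [Group π]

/-! The theorem splits into a statement about groups (the Malcev Lie algebra `𝔫` is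
finite-dimensional and nilpotent) and a statement about an arbitrary finite-dimensional nilpotent
Lie algebra.

For the group statement, suppose that the `k`-th term of the lower central series of `π` is trivial.
The key is `mem_augIdeal_pow_succ_of_primitive`, a group algebra version of the Dynkin–Specht–Wever
lemma. Convolve the antipode `S` with an operator `Y` that acts as `j` on `I ^ j / I ^ (j + 1)`.
Modulo higher order, the result sends a product of elements `g - 1` to their iterated commutator,
which comes from the lower central series and so vanishes in degree `k + 1`; on a primitive `y ∈ I ^
(k + 1)` it is multiplication by `k + 1`. Hence `y` has higher order. It follows that `𝔫` embeds
into `ℂ[π] / I ^ (k + 1)`, which is finite-dimensional, and that the filtration of `𝔫` by powers of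
`I`, which contains the lower central series of `𝔫`, reaches zero.

Flat connections with values in `𝔤` are Lie homomorphisms `𝔫 → 𝔤`. The image of such a homomorphism
is nilpotent, so if it is nonzero it has a nonzero central element `z`; the traceless `2 × 2`
matrices that commute with `z` are its multiples. Hence the connection is `η ⊗ z` with `η` closed
(`flatConnections_eq_essRankOne`).

Now let `ω = f ⊗ g` with `f` closed, and put `T = θ g`. If `T` is invertible and `f x = 1`,
contraction with `x` is a homotopy between `0` and `T + L_x`; since `L_x` is nilpotent, this is
invertible and the complex is acyclic (`exists_extCov_eq_of_isUnit`).

If `T` is singular, a class is needed in each degree up to `dim 𝔫`. For an ideal `q` of codimension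
one in `p` with `[𝔫, p] ⊆ q`, there is the exact sequence `H^(k-1)(q) → H^(k-1)(q) → H^k(p) → H^k(q)
→ H^k(q)`, whose outer maps are `L_x` and whose inner maps are multiplication by `f` and
restriction. As `L_x` is nilpotent, its kernel and cokernel on a nonzero space are nonzero, and
induction on the dimension gives Dixmier's theorem that `H^k(p) ≠ 0` for `k ≤ dim p`
(`not_relCocycles_le_relCoboundaries`). All ideals are treated inside `⋀ 𝔫*`: cochains of `p` are
represented modulo `annIdeal p`. With `q = ker f`, the two maps into and out of `H^k(𝔫)` also supply
the twisted classes: `c ⊗ v` with `v ∈ ker T` and `c` nonzero on `q` below the top degree, `f c ⊗ v`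
with `v ∉ range T` in the top degree (`exists_extCov_ne_of_det_eq_zero`). -/

@[simp] lemma augmentation_of (g : π) : augmentation π (of ℂ π g) = 1 := by
  simp [augmentation]

lemma of_sub_one_mem (g : π) : of ℂ π g - 1 ∈ augIdeal π := by
  rw [RingHom.mem_ker, map_sub, map_one]; simp [augmentation]

lemma sub_augmentation_mem_span (x : MonoidAlgebra ℂ π) :
    x - algebraMap ℂ _ (augmentation π x) ∈
      Submodule.span ℂ (Set.range fun g : π => of ℂ π g - 1) := by
  induction x using MonoidAlgebra.induction_linear with
  | zero => simp
  | add x y hx hy =>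
    rw [map_add, map_add, add_sub_add_comm]
    exact Submodule.add_mem _ hx hy
  | single g r =>
    have : (single g r : MonoidAlgebra ℂ π) - algebraMap ℂ _ (augmentation π (single g r)) =
        r • (of ℂ π g - 1) := by
      simp [augmentation, smul_sub, Algebra.algebraMap_eq_smul_one]
    rw [this]
    exact Submodule.smul_mem _ _ (Submodule.subset_span ⟨g, rfl⟩)

lemma mem_span_of_mem_augIdeal {x : MonoidAlgebra ℂ π} (hx : x ∈ augIdeal π) :
    x ∈ Submodule.span ℂ (Set.range fun g : π => of ℂ π g - 1) := by
  have h := sub_augmentation_mem_span x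
  rwa [show augmentation π x = 0 from hx, map_zero, sub_zero] at h

lemma mem_augIdeal_of_mem_span {x : MonoidAlgebra ℂ π}
    (hx : x ∈ Submodule.span ℂ (Set.range fun g : π => of ℂ π g - 1)) : x ∈ augIdeal π := by
  have : Submodule.span ℂ (Set.range fun g : π => of ℂ π g - 1) ≤
      (augIdeal π).restrictScalars ℂ := by
    rw [Submodule.span_le]
    rintro _ ⟨g, rfl⟩
    exact of_sub_one_mem g
  exact this hx

lemma augIdeal_pow_mul_mem {m n k : ℕ} (h : k ≤ m + n) {x y : MonoidAlgebra ℂ π}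
    (hx : x ∈ augIdeal π ^ m) (hy : y ∈ augIdeal π ^ n) : x * y ∈ augIdeal π ^ k := by
  refine Ideal.pow_le_pow_right h ?_
  rw [Ideal.IsTwoSided.pow_add]
  exact Ideal.mul_mem_mul hx hy

/-- Since `I ^ (n + 1) = I ^ n * I` and `I` is linearly spanned by the `g - 1`, linear statements
about `I ^ (n + 1)` need only be checked on such products. -/
lemma augIdeal_pow_succ_induction {n : ℕ} (S : Submodule ℂ (MonoidAlgebra ℂ π))
    (h : ∀ y ∈ augIdeal π ^ n, ∀ g : π, y * (of ℂ π g - 1) ∈ S)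
    {x : MonoidAlgebra ℂ π} (hx : x ∈ augIdeal π ^ (n + 1)) : x ∈ S := by
  rw [Ideal.IsTwoSided.pow_add, Submodule.pow_one] at hx
  refine Submodule.smul_induction_on hx (fun y hy a ha => ?_) fun a b => S.add_mem
  rw [smul_eq_mul]
  replace ha := mem_span_of_mem_augIdeal ha
  induction ha using Submodule.span_induction with
  | mem a ha =>
    obtain ⟨g, rfl⟩ := ha
    exact h y hy g
  | zero => simp
  | add a b ha hb h1 h2 =>
    rw [mul_add]
    exact S.add_mem h1 h2
  | smul c a ha h1 =>
    rw [mul_smul_comm]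
    exact S.smul_mem _ h1

/-- The dimension subgroup `{g | g - 1 ∈ I ^ n}`. -/
def dimensionSubgroup (π : Type*) [Group π] (n : ℕ) : Subgroup π where
  carrier := {g | of ℂ π g - 1 ∈ augIdeal π ^ n}
  one_mem' := by
    rw [Set.mem_ofPred_eq, map_one, sub_self]
    exact Ideal.zero_mem _
  mul_mem' {g h} hg hh := by
    rw [Set.mem_ofPred_eq] at *
    have : of ℂ π (g * h) - 1 = of ℂ π g * (of ℂ π h - 1) + (of ℂ π g - 1) := by
      rw [map_mul]; noncomm_ring
    rw [this]
    exact Ideal.add_mem _ (Ideal.mul_mem_left _ _ hh) hg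
  inv_mem' {g} hg := by
    rw [Set.mem_ofPred_eq] at *
    have : of ℂ π g⁻¹ - 1 = -(of ℂ π g⁻¹ * (of ℂ π g - 1)) := by
      rw [mul_sub, ← map_mul, inv_mul_cancel, map_one]; noncomm_ring
    rw [this]
    exact Ideal.neg_mem_iff _ |>.mpr (Ideal.mul_mem_left _ _ hg)

lemma mem_dimensionSubgroup {n : ℕ} {g : π} :
    g ∈ dimensionSubgroup π n ↔ of ℂ π g - 1 ∈ augIdeal π ^ n := Iff.rfl

lemma of_commutator_sub_one_mul (g h : π) :
    (of ℂ π ⁅g, h⁆ - 1) * (of ℂ π (h * g)) =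
      (of ℂ π g - 1) * (of ℂ π h - 1) - (of ℂ π h - 1) * (of ℂ π g - 1) := by
  have : of ℂ π ⁅g, h⁆ * of ℂ π (h * g) = of ℂ π g * of ℂ π h := by
    rw [← map_mul, ← map_mul, commutatorElement_def]; congr 1; group
  rw [sub_mul, this, map_mul]
  noncomm_ring

lemma of_commutator_sub_one_mem {m n k : ℕ} (hk : k ≤ m + n) {g h : π}
    (hg : of ℂ π g - 1 ∈ augIdeal π ^ m) (hh : of ℂ π h - 1 ∈ augIdeal π ^ n) :
    of ℂ π ⁅g, h⁆ - 1 ∈ augIdeal π ^ k := by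
  have : of ℂ π ⁅g, h⁆ - 1 = ((of ℂ π ⁅g, h⁆ - 1) * (of ℂ π (h * g))) * of ℂ π (h * g)⁻¹ := by
    rw [mul_assoc, ← map_mul, mul_inv_cancel, map_one, mul_one]
  rw [this, of_commutator_sub_one_mul]
  exact Ideal.mul_mem_right _ _ (Ideal.sub_mem _ (augIdeal_pow_mul_mem hk hg hh)
    (augIdeal_pow_mul_mem (by omega) hh hg))

lemma lowerCentralSeries_le_dimensionSubgroup (m : ℕ) :
    (⊤ : Subgroup π).lowerCentralSeries m ≤ dimensionSubgroup π (m + 1) := by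
  induction m with
  | zero =>
    intro g _
    rw [mem_dimensionSubgroup, zero_add, Submodule.pow_one]
    exact of_sub_one_mem g
  | succ m ih =>
    rw [Subgroup.lowerCentralSeries_succ, Subgroup.commutator_le]
    intro g hg h _
    exact of_commutator_sub_one_mem (m := m + 1) (n := 1) le_rfl (ih hg) (by rw [Submodule.pow_one]; exact of_sub_one_mem h)

/-- The symbols of the lower central series: `span {g - 1 | g ∈ γ} + I ^ (m + 2)`, where `γ` is the
`m`-th term of the lower central series. -/
def lcsSymbols (π : Type*) [Group π] (m : ℕ) : Submodule ℂ (MonoidAlgebra ℂ π) :=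
  Submodule.span ℂ ((fun g => of ℂ π g - 1) '' ((⊤ : Subgroup π).lowerCentralSeries m : Set π)) ⊔
    (augIdeal π ^ (m + 2)).restrictScalars ℂ

lemma mem_lcsSymbols_of_mem_pow {m k : ℕ} (hk : m + 2 ≤ k) {x : MonoidAlgebra ℂ π}
    (hx : x ∈ augIdeal π ^ k) : x ∈ lcsSymbols π m :=
  Submodule.mem_sup_right (Ideal.pow_le_pow_right hk hx)

lemma of_sub_one_mem_lcsSymbols {m : ℕ} {g : π}
    (hg : g ∈ (⊤ : Subgroup π).lowerCentralSeries m) : of ℂ π g - 1 ∈ lcsSymbols π m :=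
  Submodule.mem_sup_left (Submodule.subset_span ⟨g, hg, rfl⟩)

/-- The commutator of `g - 1` and `h - 1` is `(⁅g, h⁆ - 1) * (h * g)`, which agrees with `⁅g, h⁆ -
1` up to one more factor from the augmentation ideal. -/
lemma bracket_mem_lcsSymbols {m : ℕ} {x : MonoidAlgebra ℂ π} (hx : x ∈ lcsSymbols π m) (h : π) :
    x * (of ℂ π h - 1) - (of ℂ π h - 1) * x ∈ lcsSymbols π (m + 1) := by
  have hh : of ℂ π h - 1 ∈ augIdeal π ^ 1 := by rw [Submodule.pow_one]; exact of_sub_one_mem h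
  let φ : MonoidAlgebra ℂ π →ₗ[ℂ] MonoidAlgebra ℂ π :=
    LinearMap.mulRight ℂ (of ℂ π h - 1) - LinearMap.mulLeft ℂ (of ℂ π h - 1)
  suffices lcsSymbols π m ≤ (lcsSymbols π (m + 1)).comap φ from this hx
  refine sup_le (Submodule.span_le.mpr ?_) ?_
  · rintro _ ⟨g, hg, rfl⟩
    have hc : ⁅g, h⁆ ∈ (⊤ : Subgroup π).lowerCentralSeries (m + 1) :=
      Subgroup.commutator_mem_commutator hg (Subgroup.mem_top h)
    have : φ (of ℂ π g - 1) = (of ℂ π ⁅g, h⁆ - 1) +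
        (of ℂ π ⁅g, h⁆ - 1) * (of ℂ π (h * g) - 1) := by
      change (of ℂ π g - 1) * (of ℂ π h - 1) - (of ℂ π h - 1) * (of ℂ π g - 1) = _
      rw [← of_commutator_sub_one_mul]
      noncomm_ring
    change φ _ ∈ lcsSymbols π (m + 1)
    rw [this]
    refine Submodule.add_mem _ (of_sub_one_mem_lcsSymbols hc) (mem_lcsSymbols_of_mem_pow le_rfl
      (augIdeal_pow_mul_mem le_rfl (lowerCentralSeries_le_dimensionSubgroup _ hc)
        (n := 1) ?_))
    rw [Submodule.pow_one]; exact of_sub_one_mem _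
  · intro y hy
    exact mem_lcsSymbols_of_mem_pow le_rfl (Ideal.sub_mem _ (augIdeal_pow_mul_mem (m := m + 2) le_rfl hy hh)
      (augIdeal_pow_mul_mem (n := m + 2) (by omega) hh hy))

end AugmentationPowers

/-! ### A Dynkin operator on the group algebra, and primitive elements. -/

section Dynkin

open MonoidAlgebra
open scoped commutatorElement

variable {π : Type*} [Group π]

/-- The inclusion `x ↦ x ⊗ 1` of group algebras. -/
abbrev inlAlg (π : Type*) [Group π] : MonoidAlgebra ℂ π →ₐ[ℂ] MonoidAlgebra ℂ (π × π) :=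
  mapDomainAlgHom ℂ ℂ (MonoidHom.inl π π)

/-- The inclusion `x ↦ 1 ⊗ x` of group algebras. -/
abbrev inrAlg (π : Type*) [Group π] : MonoidAlgebra ℂ π →ₐ[ℂ] MonoidAlgebra ℂ (π × π) :=
  mapDomainAlgHom ℂ ℂ (MonoidHom.inr π π)

/-- The comultiplication of the group algebra. -/
abbrev diagAlg (π : Type*) [Group π] : MonoidAlgebra ℂ π →ₐ[ℂ] MonoidAlgebra ℂ (π × π) :=
  mapDomainAlgHom ℂ ℂ ((MonoidHom.id π).prod (MonoidHom.id π))

lemma mapDomainAlgHom_of {π' : Type*} [Group π'] (f : π →* π') (g : π) :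
    mapDomainAlgHom ℂ ℂ f (of ℂ π g) = of ℂ π' (f g) := by
  simp

lemma inlAlg_mul_inrAlg_of (g h : π) :
    inlAlg π (of ℂ π g) * inrAlg π (of ℂ π h) = of ℂ (π × π) (g, h) := by
  rw [mapDomainAlgHom_of, mapDomainAlgHom_of, ← map_mul]
  simp

lemma inlAlg_commute_inrAlg (a b : MonoidAlgebra ℂ π) : Commute (inlAlg π a) (inrAlg π b) := by
  induction a using MonoidAlgebra.induction_linear with
  | zero => simp
  | add a a' h h' => rw [map_add]; exact h.add_left h'
  | single g r =>
    induction b using MonoidAlgebra.induction_linear with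
    | zero => simp
    | add b b' h h' => rw [map_add]; exact h.add_right h'
    | single g' r' =>
      simp [Commute, SemiconjBy, MonoidAlgebra.single_mul_single, mul_comm r]

lemma hom_eq_of_of {W : Type*} [AddCommGroup W] [Module ℂ W] {f g : MonoidAlgebra ℂ π →ₗ[ℂ] W}
    (h : ∀ x, f (of ℂ π x) = g (of ℂ π x)) : f = g :=
  (MonoidAlgebra.basis π ℂ).ext fun x => by simpa using h x

/-- The antipode of the group algebra. -/
def antipodeMap (π : Type*) [Group π] : MonoidAlgebra ℂ π →ₗ[ℂ] MonoidAlgebra ℂ π :=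
  (MonoidAlgebra.basis π ℂ).constr ℂ fun g => of ℂ π g⁻¹

@[simp] lemma antipodeMap_of (g : π) : antipodeMap π (of ℂ π g) = of ℂ π g⁻¹ := by
  have := (MonoidAlgebra.basis π ℂ).constr_basis ℂ (fun g => of ℂ π g⁻¹) g
  rwa [basis_apply] at this

lemma antipodeMap_mul (a b : MonoidAlgebra ℂ π) :
    antipodeMap π (a * b) = antipodeMap π b * antipodeMap π a := by
  have : (LinearMap.mul ℂ (MonoidAlgebra ℂ π)).compr₂ (antipodeMap π) =
      ((LinearMap.mul ℂ (MonoidAlgebra ℂ π)).flip.compl₁₂ (antipodeMap π) (antipodeMap π)) := by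
    refine hom_eq_of_of fun g => hom_eq_of_of fun h => ?_
    change antipodeMap π (of ℂ π g * of ℂ π h) =
      antipodeMap π (of ℂ π h) * antipodeMap π (of ℂ π g)
    rw [← map_mul, antipodeMap_of, antipodeMap_of, antipodeMap_of, ← map_mul, mul_inv_rev]
  exact congr($this a b)

lemma antipodeMap_one : antipodeMap π 1 = 1 := by
  rw [← map_one (of ℂ π), antipodeMap_of, inv_one]

lemma mem_augIdeal_pow_zero (x : MonoidAlgebra ℂ π) : x ∈ augIdeal π ^ 0 := by
  rw [Submodule.pow_zero, Ideal.one_eq_top]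
  exact Submodule.mem_top

lemma antipodeMap_mem {n : ℕ} {x : MonoidAlgebra ℂ π} (hx : x ∈ augIdeal π ^ n) :
    antipodeMap π x ∈ augIdeal π ^ n := by
  induction n generalizing x with
  | zero => exact mem_augIdeal_pow_zero _
  | succ n ih =>
    refine augIdeal_pow_succ_induction
      (((augIdeal π ^ (n + 1)).restrictScalars ℂ).comap (antipodeMap π)) (fun y hy g => ?_) hx
    change antipodeMap π _ ∈ augIdeal π ^ (n + 1)
    rw [antipodeMap_mul, map_sub, antipodeMap_of, antipodeMap_one]
    refine augIdeal_pow_mul_mem (m := 1) (n := n) (by omega) ?_ (ih hy)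
    rw [Submodule.pow_one]
    exact of_sub_one_mem _

/-- The linear map `a ⊗ b ↦ S a * Y b`. -/
def antipodeConv (Y : MonoidAlgebra ℂ π →ₗ[ℂ] MonoidAlgebra ℂ π) :
    MonoidAlgebra ℂ (π × π) →ₗ[ℂ] MonoidAlgebra ℂ π :=
  (MonoidAlgebra.basis (π × π) ℂ).constr ℂ fun g => of ℂ π g.1⁻¹ * Y (of ℂ π g.2)

lemma antipodeConv_of (Y : MonoidAlgebra ℂ π →ₗ[ℂ] MonoidAlgebra ℂ π) (g h : π) :
    antipodeConv Y (of ℂ (π × π) (g, h)) = of ℂ π g⁻¹ * Y (of ℂ π h) := by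
  have := (MonoidAlgebra.basis (π × π) ℂ).constr_basis ℂ
    (fun g => of ℂ π g.1⁻¹ * Y (of ℂ π g.2)) (g, h)
  rwa [basis_apply] at this

lemma antipodeConv_inl_mul_inr (Y : MonoidAlgebra ℂ π →ₗ[ℂ] MonoidAlgebra ℂ π)
    (a b : MonoidAlgebra ℂ π) :
    antipodeConv Y (inlAlg π a * inrAlg π b) = antipodeMap π a * Y b := by
  have : ((LinearMap.mul ℂ (MonoidAlgebra ℂ (π × π))).compl₁₂ (inlAlg π).toLinearMap
      (inrAlg π).toLinearMap).compr₂ (antipodeConv Y) =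
      ((LinearMap.mul ℂ (MonoidAlgebra ℂ π)).compl₁₂ (antipodeMap π) Y) := by
    refine hom_eq_of_of fun g => hom_eq_of_of fun h => ?_
    change antipodeConv Y (inlAlg π (of ℂ π g) * inrAlg π (of ℂ π h)) =
      antipodeMap π (of ℂ π g) * Y (of ℂ π h)
    rw [inlAlg_mul_inrAlg_of, antipodeConv_of, antipodeMap_of]
  exact congr($this a b)

lemma antipodeConv_id_diag (y : MonoidAlgebra ℂ π) :
    antipodeConv LinearMap.id (diagAlg π y) = algebraMap ℂ _ (augmentation π y) := by
  have : (antipodeConv LinearMap.id).comp (diagAlg π).toLinearMap =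
      (Algebra.linearMap ℂ (MonoidAlgebra ℂ π)).comp (augmentation π).toLinearMap := by
    refine hom_eq_of_of fun g => ?_
    change antipodeConv _ (diagAlg π (of ℂ π g)) = algebraMap ℂ _ (augmentation π (of ℂ π g))
    rw [augmentation_of, map_one, mapDomainAlgHom_of]
    change antipodeConv _ (of ℂ (π × π) (g, g)) = _
    rw [antipodeConv_of, LinearMap.id_apply, ← map_mul, inv_mul_cancel, map_one]
  exact congr($this y)

/-- The `k`-th step of the filtration of `ℂ[π × π] = ℂ[π] ⊗ ℂ[π]` by total degree. -/
def tensorFiltration (π : Type*) [Group π] (k : ℕ) : Submodule ℂ (MonoidAlgebra ℂ (π × π)) :=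
  Submodule.span ℂ {x | ∃ i j : ℕ, i + j = k ∧ ∃ a ∈ augIdeal π ^ i, ∃ b ∈ augIdeal π ^ j,
    x = inlAlg π a * inrAlg π b}

lemma inl_mul_inr_mem_tensorFiltration {i j k : ℕ} (h : i + j = k) {a b : MonoidAlgebra ℂ π}
    (ha : a ∈ augIdeal π ^ i) (hb : b ∈ augIdeal π ^ j) :
    inlAlg π a * inrAlg π b ∈ tensorFiltration π k :=
  Submodule.subset_span ⟨i, j, h, a, ha, b, hb, rfl⟩

lemma tensorFiltration_induction {k : ℕ} (S : Submodule ℂ (MonoidAlgebra ℂ (π × π)))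
    (h : ∀ i j : ℕ, i + j = k → ∀ a ∈ augIdeal π ^ i, ∀ b ∈ augIdeal π ^ j,
      inlAlg π a * inrAlg π b ∈ S) {x : MonoidAlgebra ℂ (π × π)}
    (hx : x ∈ tensorFiltration π k) : x ∈ S := by
  refine Submodule.span_le.mpr ?_ hx
  rintro _ ⟨i, j, hij, a, ha, b, hb, rfl⟩
  exact h i j hij a ha b hb

lemma mul_mem_tensorFiltration {k l i j : ℕ} (hl : k + i + j = l) {x : MonoidAlgebra ℂ (π × π)}
    (hx : x ∈ tensorFiltration π k) {c d : MonoidAlgebra ℂ π}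
    (hc : c ∈ augIdeal π ^ i) (hd : d ∈ augIdeal π ^ j) :
    x * (inlAlg π c * inrAlg π d) ∈ tensorFiltration π l := by
  refine tensorFiltration_induction
    ((tensorFiltration π l).comap (LinearMap.mulRight ℂ (inlAlg π c * inrAlg π d)))
    (fun i' j' h a ha b hb => ?_) hx
  change inlAlg π a * inrAlg π b * (inlAlg π c * inrAlg π d) ∈ tensorFiltration π l
  rw [mul_assoc, ← mul_assoc (inrAlg π b), ← (inlAlg_commute_inrAlg c b).eq, mul_assoc,
    ← mul_assoc, ← map_mul, ← map_mul]
  exact inl_mul_inr_mem_tensorFiltration (i := i' + i) (j := j' + j) (by omega)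
    (augIdeal_pow_mul_mem le_rfl ha hc) (augIdeal_pow_mul_mem le_rfl hb hd)

/-- Each factor splits as `(g, h) - 1 = (g - 1) ⊗ h + 1 ⊗ (h - 1)`, and either summand raises the
total degree by one. -/
lemma augIdeal_pow_le_tensorFiltration {n : ℕ} {x : MonoidAlgebra ℂ (π × π)}
    (hx : x ∈ augIdeal (π × π) ^ n) : x ∈ tensorFiltration π n := by
  induction n generalizing x with
  | zero =>
    induction x using MonoidAlgebra.induction_linear with
    | zero => exact Submodule.zero_mem _
    | add a b ha hb => exact Submodule.add_mem _ (ha (mem_augIdeal_pow_zero _)) (hb (mem_augIdeal_pow_zero _))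
    | single g r =>
      have : (single g r : MonoidAlgebra ℂ (π × π)) =
          r • (inlAlg π (of ℂ π g.1) * inrAlg π (of ℂ π g.2)) := by
        rw [inlAlg_mul_inrAlg_of]; simp
      rw [this]
      exact Submodule.smul_mem _ _ (inl_mul_inr_mem_tensorFiltration (i := 0) (j := 0) rfl
        (mem_augIdeal_pow_zero _) (mem_augIdeal_pow_zero _))
  | succ n ih =>
    refine augIdeal_pow_succ_induction (tensorFiltration π (n + 1)) (fun y hy g => ?_) hx
    have : y * (of ℂ (π × π) g - 1) =
        y * (inlAlg π (of ℂ π g.1 - 1) * inrAlg π (of ℂ π g.2)) +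
          y * (inlAlg π 1 * inrAlg π (of ℂ π g.2 - 1)) := by
      rw [← mul_add, map_sub, sub_mul, inlAlg_mul_inrAlg_of, map_one (inlAlg π), one_mul, one_mul,
        map_sub, map_one (inrAlg π), sub_add_sub_cancel]
    rw [this]
    refine Submodule.add_mem _ (mul_mem_tensorFiltration (i := 1) (j := 0) rfl (ih hy) ?_ ?_)
      (mul_mem_tensorFiltration (i := 0) (j := 1) rfl (ih hy) ?_ ?_)
    · rw [Submodule.pow_one]; exact of_sub_one_mem _
    · exact mem_augIdeal_pow_zero _
    · exact mem_augIdeal_pow_zero _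
    · rw [Submodule.pow_one]; exact of_sub_one_mem _

lemma diagAlg_mem {k : ℕ} {y : MonoidAlgebra ℂ π} (hy : y ∈ augIdeal π ^ k) :
    diagAlg π y ∈ tensorFiltration π k :=
  augIdeal_pow_le_tensorFiltration (augIdeal_pow_le_comap _ k hy)

/-- A linear operator that preserves the powers of the augmentation ideal and acts as `j` on
`I ^ j / I ^ (j + 1)`, for `j ≤ K`. -/
structure IsEuler (Y : MonoidAlgebra ℂ π →ₗ[ℂ] MonoidAlgebra ℂ π) (K : ℕ) : Prop where
  mem : ∀ j, ∀ b ∈ augIdeal π ^ j, Y b ∈ augIdeal π ^ j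
  sub_mem : ∀ j ≤ K, ∀ b ∈ augIdeal π ^ j, Y b - (j : ℂ) • b ∈ augIdeal π ^ (j + 1)

/-- The operator is a sum of linear retractions onto `I ^ 1, ..., I ^ K`. On `I ^ j` the first `j`
of them are the identity, and the others land in `I ^ (j + 1)`. -/
lemma exists_isEuler (π : Type*) [Group π] (K : ℕ) :
    ∃ Y : MonoidAlgebra ℂ π →ₗ[ℂ] MonoidAlgebra ℂ π, IsEuler Y K := by
  -- The induction needs exact equality on `I ^ K`, so that adding a retraction onto `I ^ (K + 1)`
  -- gives exactly `K + 1` there.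
  suffices ∃ Y : MonoidAlgebra ℂ π →ₗ[ℂ] MonoidAlgebra ℂ π,
      IsEuler Y K ∧ ∀ b ∈ augIdeal π ^ K, Y b = (K : ℂ) • b from this.imp fun _ h => h.1
  induction K with
  | zero => exact ⟨0, ⟨fun j b _ => by simp, fun j hj b _ => by simp [Nat.le_zero.mp hj]⟩,
      fun b _ => by simp⟩
  | succ K ih =>
    obtain ⟨Y, hY, hYK⟩ := ih
    obtain ⟨p, hp⟩ :=
      ((augIdeal π ^ (K + 1)).restrictScalars ℂ).subtype.exists_leftInverse_of_injective
        (Submodule.ker_subtype _)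
    have hpid : ∀ b ∈ augIdeal π ^ (K + 1), (p b : MonoidAlgebra ℂ π) = b := fun b hb =>
      congrArg Subtype.val (LinearMap.congr_fun hp ⟨b, hb⟩)
    have hpmem : ∀ b, (p b : MonoidAlgebra ℂ π) ∈ augIdeal π ^ (K + 1) := fun b => (p b).2
    have hsucc : ∀ b ∈ augIdeal π ^ (K + 1),
        Y b + (p b : MonoidAlgebra ℂ π) = ((K + 1 : ℕ) : ℂ) • b := fun b hb => by
      rw [hYK b (Ideal.pow_le_pow_right K.le_succ hb), hpid b hb]
      push_cast
      module
    refine ⟨Y + ((augIdeal π ^ (K + 1)).restrictScalars ℂ).subtype.comp p,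
      ⟨fun j b hb => ?_, fun j hj b hb => ?_⟩, hsucc⟩
    · refine Ideal.add_mem _ (hY.mem j b hb) ?_
      change (p b : MonoidAlgebra ℂ π) ∈ _
      rcases le_total j (K + 1) with h | h
      · exact Ideal.pow_le_pow_right h (hpmem b)
      · rwa [hpid b (Ideal.pow_le_pow_right h hb)]
    · change Y b + (p b : MonoidAlgebra ℂ π) - _ ∈ _
      rcases hj.lt_or_eq with h | rfl
      · rw [add_sub_right_comm]
        exact Ideal.add_mem _ (hY.sub_mem j (by omega) b hb)
          (Ideal.pow_le_pow_right (by omega) (hpmem b))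
      · rw [hsucc b hb, sub_self]
        exact Ideal.zero_mem _

section

variable {Y : MonoidAlgebra ℂ π →ₗ[ℂ] MonoidAlgebra ℂ π} {K : ℕ}

lemma IsEuler.antipodeConv_mem (hY : IsEuler Y K) {k : ℕ} {w : MonoidAlgebra ℂ (π × π)}
    (hw : w ∈ tensorFiltration π k) : antipodeConv Y w ∈ augIdeal π ^ k := by
  refine tensorFiltration_induction
    (((augIdeal π ^ k).restrictScalars ℂ).comap (antipodeConv Y)) (fun i j hij a ha b hb => ?_) hw
  change antipodeConv Y _ ∈ augIdeal π ^ k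
  rw [antipodeConv_inl_mul_inr]
  exact augIdeal_pow_mul_mem hij.ge (antipodeMap_mem ha) (hY.mem j b hb)

lemma antipodeConv_mul_inl {k : ℕ} {w : MonoidAlgebra ℂ (π × π)}
    (hw : w ∈ tensorFiltration π k) (c : MonoidAlgebra ℂ π) :
    antipodeConv Y (w * inlAlg π c) = antipodeMap π c * antipodeConv Y w := by
  rw [← sub_eq_zero]
  let φ := (antipodeConv Y).comp (LinearMap.mulRight ℂ (inlAlg π c)) -
    (LinearMap.mulLeft ℂ (antipodeMap π c)).comp (antipodeConv Y)
  refine tensorFiltration_induction (LinearMap.ker φ) (fun i j hij a ha b hb => ?_) hw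
  change antipodeConv Y (inlAlg π a * inrAlg π b * inlAlg π c) -
    antipodeMap π c * antipodeConv Y (inlAlg π a * inrAlg π b) = 0
  rw [mul_assoc, ← (inlAlg_commute_inrAlg c b).eq, ← mul_assoc, ← map_mul,
    antipodeConv_inl_mul_inr, antipodeConv_inl_mul_inr, antipodeMap_mul, mul_assoc, sub_self]

/-- Multiplying by `c` raises the degree of the second factor from `j` to `j + 1`, so `Y (b * c)`
agrees with `Y b * c + b * c` up to higher order. The extra term is the convolution of the antipode
with the identity, that is, the augmentation when applied to a diagonal. -/
lemma IsEuler.antipodeConv_mul_inr (hY : IsEuler Y K) {k : ℕ} (hk : k + 1 ≤ K)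
    {w : MonoidAlgebra ℂ (π × π)} (hw : w ∈ tensorFiltration π k) {c : MonoidAlgebra ℂ π}
    (hc : c ∈ augIdeal π ^ 1) :
    antipodeConv Y (w * inrAlg π c) - antipodeConv Y w * c - antipodeConv LinearMap.id w * c ∈
      augIdeal π ^ (k + 2) := by
  let φ : MonoidAlgebra ℂ (π × π) →ₗ[ℂ] MonoidAlgebra ℂ π :=
    (antipodeConv Y).comp (LinearMap.mulRight ℂ (inrAlg π c)) -
    (LinearMap.mulRight ℂ c).comp (antipodeConv Y) -
    (LinearMap.mulRight ℂ c).comp (antipodeConv LinearMap.id)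
  have hφ : ∀ w, φ w = antipodeConv Y (w * inrAlg π c) - antipodeConv Y w * c -
    antipodeConv LinearMap.id w * c := fun _ => rfl
  rw [← hφ, ← Submodule.restrictScalars_mem ℂ, ← Submodule.mem_comap]
  refine tensorFiltration_induction _ (fun i j hij a ha b hb => ?_) hw
  rw [Submodule.mem_comap, Submodule.restrictScalars_mem, hφ]
  rw [mul_assoc, ← map_mul, antipodeConv_inl_mul_inr, antipodeConv_inl_mul_inr,
    antipodeConv_inl_mul_inr, LinearMap.id_apply, mul_assoc, mul_assoc, ← mul_sub, ← mul_sub]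
  refine augIdeal_pow_mul_mem (m := i) (n := j + 2) (by omega) (antipodeMap_mem ha) ?_
  have h1 := hY.sub_mem (j + 1) (by omega) (b * c) (augIdeal_pow_mul_mem le_rfl hb hc)
  have h2 := augIdeal_pow_mul_mem (k := j + 2) (m := j + 1) (n := 1) le_rfl (hY.sub_mem j (by omega) b hb) hc
  have : Y (b * c) - Y b * c - b * c =
      (Y (b * c) - ((j + 1 : ℕ) : ℂ) • (b * c)) - (Y b - (j : ℂ) • b) * c := by
    rw [sub_mul, smul_mul_assoc]
    push_cast
    module
  rw [this]
  exact Ideal.sub_mem _ h1 h2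

/-- The Dynkin operator `y ↦ S(y') * Y(y'')` maps a product of elements of the augmentation ideal to
their iterated commutator, up to terms of higher order. -/
lemma IsEuler.antipodeConv_diag_mul (hY : IsEuler Y K) {k : ℕ} (hk : k + 2 ≤ K)
    {y : MonoidAlgebra ℂ π} (hy : y ∈ augIdeal π ^ (k + 1)) (g : π) :
    antipodeConv Y (diagAlg π (y * (of ℂ π g - 1))) -
      (antipodeConv Y (diagAlg π y) * (of ℂ π g - 1) -
        (of ℂ π g - 1) * antipodeConv Y (diagAlg π y)) ∈ augIdeal π ^ (k + 3) := by
  set c := of ℂ π g - 1 with hc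
  have hc1 : c ∈ augIdeal π ^ 1 := by rw [Submodule.pow_one]; exact of_sub_one_mem g
  have hw := diagAlg_mem hy
  set w := diagAlg π y with hwdef
  -- With `c = g - 1`, the three summands of `Δ c` contribute respectively `S(c) D(y)`, which is `-c
  -- D(y)` up to higher order, then `D(y) c`, and a term of higher order; here `D` is the
  -- convolution of `S` and `Y`.
  have hdiag : diagAlg π c = inlAlg π c + inrAlg π c + inlAlg π c * inrAlg π c := by
    have h1 : diagAlg π (of ℂ π g) = inlAlg π (of ℂ π g) * inrAlg π (of ℂ π g) := by
      rw [inlAlg_mul_inrAlg_of, mapDomainAlgHom_of]; rfl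
    rw [hc, map_sub, map_sub, map_sub, h1, map_one (diagAlg π), map_one (inlAlg π),
      map_one (inrAlg π)]
    noncomm_ring
  have hE : antipodeConv LinearMap.id w = 0 := by
    have : y ∈ augIdeal π := by
      have := Ideal.pow_le_pow_right (Nat.le_add_left 1 k) hy
      rwa [Submodule.pow_one] at this
    rw [hwdef, antipodeConv_id_diag, show augmentation π y = 0 from this, map_zero]
  have h1 := hY.antipodeConv_mul_inr (by omega) hw hc1
  rw [hE, zero_mul, sub_zero] at h1
  have h2 := hY.antipodeConv_mem (mul_mem_tensorFiltration (l := k + 3) (by omega) hw hc1 hc1)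
  have h3 : (antipodeMap π c + c) * antipodeConv Y w ∈ augIdeal π ^ (k + 3) := by
    refine augIdeal_pow_mul_mem (m := 2) (n := k + 1) (by omega) ?_ (hY.antipodeConv_mem hw)
    -- The antipode is `-1` on `I / I ^ 2`; the error is this explicit product of two elements of
    -- `I`.
    have : antipodeMap π c + c = -((of ℂ π g - 1) * (of ℂ π g⁻¹ - 1)) := by
      rw [hc, map_sub, antipodeMap_of, antipodeMap_one, sub_mul, mul_sub, ← map_mul,
        mul_inv_cancel, map_one]
      noncomm_ring
    rw [this, neg_mem_iff]
    refine augIdeal_pow_mul_mem (m := 1) (n := 1) le_rfl hc1 ?_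
    rw [Submodule.pow_one]
    exact of_sub_one_mem _
  have : antipodeConv Y (diagAlg π (y * c)) -
      (antipodeConv Y w * c - c * antipodeConv Y w) =
      (antipodeMap π c + c) * antipodeConv Y w +
        (antipodeConv Y (w * inrAlg π c) - antipodeConv Y w * c) +
        antipodeConv Y (w * (inlAlg π c * inrAlg π c)) := by
    rw [map_mul, hdiag, mul_add, mul_add, map_add, map_add, antipodeConv_mul_inl hw]
    noncomm_ring
  rw [this]
  exact Ideal.add_mem _ (Ideal.add_mem _ h3 h1) h2

lemma IsEuler.apply_one_mem (hY : IsEuler Y K) : Y 1 ∈ augIdeal π ^ 1 := by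
  have := hY.sub_mem 0 (Nat.zero_le _) 1 (mem_augIdeal_pow_zero _)
  simpa using this

/-- Each further factor `g - 1` acts by a commutator up to higher order, and commutators move the
symbols of one term of the lower central series into those of the next. -/
lemma IsEuler.antipodeConv_diag_mem (hY : IsEuler Y K) {k : ℕ} (hk : k + 1 ≤ K)
    {y : MonoidAlgebra ℂ π} (hy : y ∈ augIdeal π ^ (k + 1)) :
    antipodeConv Y (diagAlg π y) ∈ lcsSymbols π k := by
  induction k generalizing y with
  | zero =>
    have hy' : y ∈ augIdeal π := by rwa [zero_add, Submodule.pow_one] at hy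
    replace hy' := mem_span_of_mem_augIdeal hy'
    refine (Submodule.span_le (p := (lcsSymbols π 0).comap
      ((antipodeConv Y).comp (diagAlg π).toLinearMap))).mpr ?_ hy'
    rintro _ ⟨g, rfl⟩
    change antipodeConv Y (diagAlg π (of ℂ π g - 1)) ∈ lcsSymbols π 0
    have hg : ∀ g : π, of ℂ π g - 1 ∈ augIdeal π ^ 1 := fun g => by
      rw [Submodule.pow_one]; exact of_sub_one_mem g
    have h1 : diagAlg π (of ℂ π g - 1) = of ℂ (π × π) (g, g) - of ℂ (π × π) (1, 1) := by
      rw [map_sub, mapDomainAlgHom_of, map_one, ← map_one (of ℂ (π × π))]; rfl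
    have h2 : antipodeConv Y (diagAlg π (of ℂ π g - 1)) = (of ℂ π g - 1) +
        ((Y (of ℂ π g - 1) - ((1 : ℕ) : ℂ) • (of ℂ π g - 1)) +
          (of ℂ π g⁻¹ - 1) * Y (of ℂ π g - 1) + (of ℂ π g⁻¹ - 1) * Y 1) := by
      rw [h1, map_sub, antipodeConv_of, antipodeConv_of, map_sub, inv_one, map_one]
      push_cast
      rw [one_smul]
      noncomm_ring
    rw [h2]
    refine Submodule.add_mem _ (of_sub_one_mem_lcsSymbols (Subgroup.mem_top g))
      (mem_lcsSymbols_of_mem_pow le_rfl ?_)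
    refine Ideal.add_mem _ (Ideal.add_mem _ (hY.sub_mem 1 (by omega) _ (hg g)) ?_) ?_
    · exact augIdeal_pow_mul_mem (m := 1) (n := 1) le_rfl (hg _) (hY.mem 1 _ (hg g))
    · exact augIdeal_pow_mul_mem (m := 1) (n := 1) le_rfl (hg _) hY.apply_one_mem
  | succ k ih =>
    refine augIdeal_pow_succ_induction ((lcsSymbols π (k + 1)).comap
      ((antipodeConv Y).comp (diagAlg π).toLinearMap)) (fun y hy g => ?_) hy
    change antipodeConv Y (diagAlg π _) ∈ lcsSymbols π (k + 1)
    rw [← sub_add_cancel (antipodeConv Y _) (antipodeConv Y (diagAlg π y) * (of ℂ π g - 1) -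
        (of ℂ π g - 1) * antipodeConv Y (diagAlg π y))]
    exact Submodule.add_mem _
      (mem_lcsSymbols_of_mem_pow le_rfl (hY.antipodeConv_diag_mul (by omega) hy g))
      (bracket_mem_lcsSymbols (ih (by omega) hy) g)

end

/-- If the `k`-th term of the lower central series is trivial, then `I ^ (k + 1)` contains no elements
that are primitive modulo higher order, except those of `I ^ (k + 2)`. -/
lemma mem_augIdeal_pow_succ_of_primitive {k : ℕ}
    (hk : (⊤ : Subgroup π).lowerCentralSeries k = ⊥) {y : MonoidAlgebra ℂ π}
    (hy : y ∈ augIdeal π ^ (k + 1))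
    (hprim : diagAlg π y - (inlAlg π y + inrAlg π y) ∈ augIdeal (π × π) ^ (k + 2)) :
    y ∈ augIdeal π ^ (k + 2) := by
  obtain ⟨Y, hY⟩ := exists_isEuler π (k + 1)
  have h1 := hY.antipodeConv_diag_mem le_rfl hy
  have h1' : antipodeConv Y (diagAlg π y) ∈ augIdeal π ^ (k + 2) := by
    have : lcsSymbols π k ≤ (augIdeal π ^ (k + 2)).restrictScalars ℂ := by
      refine sup_le (Submodule.span_le.mpr ?_) le_rfl
      rintro _ ⟨g, hg, rfl⟩
      rw [hk] at hg
      have : g = 1 := hg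
      subst this
      change of ℂ π 1 - 1 ∈ augIdeal π ^ (k + 2)
      rw [map_one, sub_self]
      exact Ideal.zero_mem _
    exact this h1
  have h2 := hY.antipodeConv_mem (augIdeal_pow_le_tensorFiltration hprim)
  have h3 : antipodeConv Y (inlAlg π y) = antipodeMap π y * Y 1 := by
    rw [← antipodeConv_inl_mul_inr, map_one, mul_one]
  have h4 : antipodeConv Y (inrAlg π y) = Y y := by
    rw [← one_mul (Y y), ← antipodeMap_one, ← antipodeConv_inl_mul_inr, map_one, one_mul]
  have h5 : antipodeMap π y * Y 1 ∈ augIdeal π ^ (k + 2) :=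
    augIdeal_pow_mul_mem (m := k + 1) (n := 1) le_rfl (antipodeMap_mem hy) hY.apply_one_mem
  have h6 := hY.sub_mem (k + 1) le_rfl y hy
  -- For primitive `y` the convolution is `S(y) Y(1) + Y(y)`. Its first term has higher order
  -- because `Y 1 ∈ I`, and its second is `(k + 1) y` modulo higher order.
  have h7 : ((k + 1 : ℕ) : ℂ) • y ∈ (augIdeal π ^ (k + 2)).restrictScalars ℂ := by
    have : ((k + 1 : ℕ) : ℂ) • y = antipodeConv Y (diagAlg π y) - antipodeMap π y * Y 1 -
        antipodeConv Y (diagAlg π y - (inlAlg π y + inrAlg π y)) -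
        (Y y - ((k + 1 : ℕ) : ℂ) • y) := by
      rw [map_sub, map_add, h3, h4]
      abel
    rw [this]
    exact Submodule.sub_mem _ (Submodule.sub_mem _ (Submodule.sub_mem _ h1' h5) h2) h6
  exact (Submodule.smul_mem_iff _ (Nat.cast_ne_zero.mpr (Nat.succ_ne_zero k))).mp h7

end Dynkin

/-! ### Finite dimension and nilpotency of the Malcev Lie algebra. -/

section MalcevFinite

open MonoidAlgebra

variable {π : Type*} [Group π]

/-- Modulo `I ^ 2`, the map `g ↦ g - 1` turns products into sums, so the elements coming from a
finite generating set suffice. -/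
lemma exists_fg_augIdeal_le (π : Type*) [Group π] [Group.FG π] :
    ∃ U : Submodule ℂ (MonoidAlgebra ℂ π), U.FG ∧
      ∀ g : π, of ℂ π g - 1 ∈ U ⊔ (augIdeal π ^ 2).restrictScalars ℂ := by
  obtain ⟨S, hS⟩ := Group.fg_def.mp (inferInstance : Group.FG π)
  refine ⟨Submodule.span ℂ ((fun g => of ℂ π g - 1) '' (S : Set π)),
    Submodule.fg_span (S.finite_toSet.image _), fun g => ?_⟩
  set U := Submodule.span ℂ ((fun g => of ℂ π g - 1) '' (S : Set π))
  have hsq : ∀ g h : π, (of ℂ π g - 1) * (of ℂ π h - 1) ∈ U ⊔ (augIdeal π ^ 2).restrictScalars ℂ :=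
    fun g h => Submodule.mem_sup_right (augIdeal_pow_mul_mem (m := 1) (n := 1) le_rfl
      (by rw [Submodule.pow_one]; exact of_sub_one_mem g)
      (by rw [Submodule.pow_one]; exact of_sub_one_mem h))
  have hg : g ∈ Subgroup.closure (S : Set π) := hS ▸ Subgroup.mem_top g
  induction hg using Subgroup.closure_induction with
  | mem g hg => exact Submodule.mem_sup_left (Submodule.subset_span ⟨g, hg, rfl⟩)
  | one => rw [map_one, sub_self]; exact Submodule.zero_mem _
  | mul g h _ _ hg hh =>
    have : of ℂ π (g * h) - 1 =
        (of ℂ π g - 1) * (of ℂ π h - 1) + (of ℂ π g - 1) + (of ℂ π h - 1) := by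
      rw [map_mul]; noncomm_ring
    rw [this]
    exact Submodule.add_mem _ (Submodule.add_mem _ (hsq g h) hg) hh
  | inv g _ hg =>
    have : of ℂ π g⁻¹ - 1 = -((of ℂ π g - 1) * (of ℂ π g⁻¹ - 1)) - (of ℂ π g - 1) := by
      rw [sub_mul, mul_sub, ← map_mul, mul_inv_cancel, map_one]; noncomm_ring
    rw [this]
    exact Submodule.sub_mem _ (Submodule.neg_mem _ (hsq g g⁻¹)) hg

lemma exists_fg_augIdeal_pow_le (π : Type*) [Group π] [Group.FG π] (n : ℕ) :
    ∃ W : Submodule ℂ (MonoidAlgebra ℂ π), W.FG ∧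
      ∀ x ∈ augIdeal π ^ n, x ∈ W ⊔ (augIdeal π ^ (n + 1)).restrictScalars ℂ := by
  obtain ⟨U, hU, hUI⟩ := exists_fg_augIdeal_le π
  induction n with
  | zero =>
    refine ⟨Submodule.span ℂ {1}, Submodule.fg_span (Set.finite_singleton 1), fun x _ => ?_⟩
    rw [← add_sub_cancel (algebraMap ℂ (MonoidAlgebra ℂ π) (augmentation π x)) x]
    refine Submodule.add_mem _ (Submodule.mem_sup_left ?_) (Submodule.mem_sup_right ?_)
    · rw [Algebra.algebraMap_eq_smul_one]
      exact Submodule.smul_mem _ _ (Submodule.mem_span_singleton_self 1)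
    · rw [Submodule.restrictScalars_mem, zero_add, Submodule.pow_one]
      exact mem_augIdeal_of_mem_span (sub_augmentation_mem_span x)
  | succ n ih =>
    obtain ⟨W, hW, hWI⟩ := ih
    refine ⟨W * U, hW.mul hU, fun x hx => augIdeal_pow_succ_induction _ (fun y hy g => ?_) hx⟩
    obtain ⟨w, hw, z, hz, hwz⟩ := Submodule.mem_sup.mp (hWI y hy)
    obtain ⟨u, hu, v, hv, huv⟩ := Submodule.mem_sup.mp (hUI g)
    -- `W` need not lie in `I ^ n`, but the element `w` at hand does, as a difference of two
    -- elements of `I ^ n`.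
    have hw' : w ∈ augIdeal π ^ n := by
      rw [← add_sub_cancel_right w z, hwz]
      exact Ideal.sub_mem _ hy (Ideal.pow_le_pow_right n.le_succ hz)
    have : y * (of ℂ π g - 1) = w * u + (w * v + z * (of ℂ π g - 1)) := by
      rw [← hwz, ← huv]; noncomm_ring
    rw [this]
    refine Submodule.add_mem _ (Submodule.mem_sup_left (Submodule.mul_mem_mul hw hu))
      (Submodule.mem_sup_right (Ideal.add_mem _ ?_ ?_))
    · exact augIdeal_pow_mul_mem (m := n) (n := 2) le_rfl hw' hv
    · refine augIdeal_pow_mul_mem (m := n + 1) (n := 1) le_rfl hz ?_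
      rw [Submodule.pow_one]
      exact of_sub_one_mem g

lemma finite_quotient_augIdeal_pow (π : Type*) [Group π] [Group.FG π] (n : ℕ) :
    Module.Finite ℂ (MonoidAlgebra ℂ π ⧸ augIdeal π ^ n) := by
  have key : ∃ W : Submodule ℂ (MonoidAlgebra ℂ π), W.FG ∧
      ∀ x, x ∈ W ⊔ (augIdeal π ^ n).restrictScalars ℂ := by
    induction n with
    | zero => exact ⟨⊥, Submodule.fg_bot, fun x =>
        Submodule.mem_sup_right (mem_augIdeal_pow_zero x)⟩
    | succ n ih =>
      obtain ⟨W, hW, hWI⟩ := ih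
      obtain ⟨W', hW', hWI'⟩ := exists_fg_augIdeal_pow_le π n
      refine ⟨W ⊔ W', hW.sup hW', fun x => ?_⟩
      obtain ⟨w, hw, z, hz, rfl⟩ := Submodule.mem_sup.mp (hWI x)
      rw [sup_assoc]
      exact Submodule.add_mem_sup hw (hWI' z hz)
  obtain ⟨W, hW, hWI⟩ := key
  have := Module.Finite.iff_fg.mpr hW
  refine Module.Finite.of_surjective
    ((Ideal.Quotient.mkₐ ℂ (augIdeal π ^ n)).toLinearMap.comp W.subtype) fun q => ?_
  obtain ⟨x, rfl⟩ := Ideal.Quotient.mk_surjective q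
  obtain ⟨w, hw, z, hz, rfl⟩ := Submodule.mem_sup.mp (hWI x)
  refine ⟨⟨w, hw⟩, ?_⟩
  change Ideal.Quotient.mk _ w = Ideal.Quotient.mk _ (w + z)
  rw [map_add, Ideal.Quotient.eq_zero_iff_mem.mpr hz, add_zero]

namespace MalcevLieAlgebra

/-- The image of an element of the Malcev Lie algebra in `ℂ[π] / I ^ n`. -/
def proj (π : Type*) [Group π] (n : ℕ) :
    MalcevLieAlgebra π →ₗ[ℂ] (MonoidAlgebra ℂ π ⧸ augIdeal π ^ n) :=
  (LinearMap.proj n).comp ((CompletedGroupAlgebra π).val.toLinearMap.comp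
    (malcevSubalgebra π).toSubmodule.subtype)

lemma proj_lie (n : ℕ) (x y : MalcevLieAlgebra π) :
    proj π n ⁅x, y⁆ = proj π n x * proj π n y - proj π n y * proj π n x := rfl

lemma ext_proj {x y : MalcevLieAlgebra π} (h : ∀ n, proj π n x = proj π n y) : x = y :=
  Subtype.ext (Subtype.ext (funext h))

lemma proj_eq_of_mk {m n : ℕ} (h : m ≤ n) {x : MalcevLieAlgebra π} {y : MonoidAlgebra ℂ π}
    (hy : proj π n x = Ideal.Quotient.mk _ y) : proj π m x = Ideal.Quotient.mk _ y := by
  have h1 := x.1.2 m n h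
  change Ideal.Quotient.factorₐ ℂ _ (proj π n x) = proj π m x at h1
  rw [← h1, hy]
  rfl

lemma primitive_of_mk {n : ℕ} {x : MalcevLieAlgebra π} {y : MonoidAlgebra ℂ π}
    (hy : proj π n x = Ideal.Quotient.mk _ y) :
    diagAlg π y - (inlAlg π y + inrAlg π y) ∈ augIdeal (π × π) ^ n := by
  have h := congrFun (congrArg Subtype.val x.2) n
  change quotientMap _ n (proj π n x) = quotientMap _ n (proj π n x) +
    quotientMap _ n (proj π n x) at h
  rw [hy] at h
  exact Ideal.Quotient.eq.mp h

lemma exists_mk (n : ℕ) (x : MalcevLieAlgebra π) :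
    ∃ y : MonoidAlgebra ℂ π, proj π n x = Ideal.Quotient.mk _ y :=
  (Ideal.Quotient.mk_surjective (proj π n x)).imp fun _ h => h.symm

lemma mem_pow_of_mk {m n : ℕ} (h : m ≤ n) {x : MalcevLieAlgebra π} {y : MonoidAlgebra ℂ π}
    (hy : proj π n x = Ideal.Quotient.mk _ y) (hx : proj π m x = 0) : y ∈ augIdeal π ^ m := by
  rw [← Ideal.Quotient.eq_zero_iff_mem, ← proj_eq_of_mk h hy, hx]

/-- Applying the augmentation to `Δ y = y ⊗ 1 + 1 ⊗ y` gives `ε(y) = 2 ε(y)`. -/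
lemma proj_one (x : MalcevLieAlgebra π) : proj π 1 x = 0 := by
  obtain ⟨y, hy⟩ := exists_mk 1 x
  have h := primitive_of_mk hy
  rw [Submodule.pow_one, RingHom.mem_ker, map_sub, map_add] at h
  have haug : ∀ f : π →* π × π, augmentation (π × π) (mapDomainAlgHom ℂ ℂ f y) =
      augmentation π y := by
    intro f
    have : (augmentation (π × π)).comp (mapDomainAlgHom ℂ ℂ f) = augmentation π := by
      ext; simp [augmentation]
    exact congr($this y)
  rw [haug, haug, haug, sub_add_cancel_left, neg_eq_zero] at h
  rw [hy, Ideal.Quotient.eq_zero_iff_mem, Submodule.pow_one]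
  exact h

lemma proj_succ_eq_zero {k : ℕ} (hk : (⊤ : Subgroup π).lowerCentralSeries k = ⊥)
    {x : MalcevLieAlgebra π} (hx : proj π (k + 1) x = 0) : proj π (k + 2) x = 0 := by
  obtain ⟨y, hy⟩ := exists_mk (k + 2) x
  rw [hy, Ideal.Quotient.eq_zero_iff_mem]
  exact mem_augIdeal_pow_succ_of_primitive hk (mem_pow_of_mk (Nat.le_succ _) hy hx)
    (primitive_of_mk hy)

/-- All later terms of the lower central series are trivial too, so vanishing modulo `I ^ (k + 1)`
propagates to every power of `I`. -/
lemma eq_zero_of_proj {k : ℕ} (hk : (⊤ : Subgroup π).lowerCentralSeries k = ⊥)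
    {x : MalcevLieAlgebra π} (hx : proj π (k + 1) x = 0) : x = 0 := by
  have hge : ∀ m, proj π (k + m + 1) x = 0 := by
    intro m
    induction m with
    | zero => exact hx
    | succ m ih =>
      exact proj_succ_eq_zero (eq_bot_iff.mpr (hk ▸
        Subgroup.lowerCentralSeries_antitone _ (Nat.le_add_right k m))) ih
  refine ext_proj fun n => ?_
  obtain ⟨y, hy⟩ := exists_mk (k + n + 1) x
  rw [map_zero, proj_eq_of_mk (by omega) hy, Ideal.Quotient.eq_zero_iff_mem]
  exact Ideal.pow_le_pow_right (by omega) (mem_pow_of_mk le_rfl hy (hge n))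

theorem finite (π : Type*) [Group π] [Group.FG π] [Group.IsNilpotent π] :
    Module.Finite ℂ (MalcevLieAlgebra π) := by
  obtain ⟨k, hk⟩ := Subgroup.nilpotent_iff_lowerCentralSeries.mp (inferInstance : Group.IsNilpotent π)
  have := finite_quotient_augIdeal_pow π (k + 1)
  refine Module.Finite.of_injective (proj π (k + 1)) ?_
  rw [← LinearMap.ker_eq_bot, eq_bot_iff]
  exact fun x hx => eq_zero_of_proj hk hx

/-- The filtration of the Malcev Lie algebra induced by the powers of the augmentation ideal. -/
def filtration (π : Type*) [Group π] (n : ℕ) : LieIdeal ℂ (MalcevLieAlgebra π) where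
  toSubmodule := LinearMap.ker (proj π n)
  lie_mem {x m} hm := by
    change proj π n _ = 0
    change proj π n m = 0 at hm
    rw [proj_lie, hm, mul_zero, zero_mul, sub_zero]

lemma mem_filtration {n : ℕ} {x : MalcevLieAlgebra π} :
    x ∈ filtration π n ↔ proj π n x = 0 := Iff.rfl

/-- The shift by one is `proj_one`: every primitive element already has order one, so each bracket
raises the order by at least one. -/
lemma lowerCentralSeries_le_filtration (n : ℕ) :
    LieModule.lowerCentralSeries ℂ (MalcevLieAlgebra π) (MalcevLieAlgebra π) n ≤
      filtration π (n + 1) := by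
  induction n with
  | zero => exact fun x _ => mem_filtration.mpr (proj_one x)
  | succ n ih =>
    rw [LieModule.lowerCentralSeries_succ, LieSubmodule.lie_le_iff]
    intro x _ m hm
    replace hm := mem_filtration.mp (ih hm)
    obtain ⟨y, hy⟩ := exists_mk (n + 2) x
    obtain ⟨z, hz⟩ := exists_mk (n + 2) m
    have hyI := mem_pow_of_mk (m := 1) (by omega) hy (proj_one x)
    have hzI := mem_pow_of_mk (m := n + 1) (by omega) hz hm
    rw [mem_filtration, proj_lie, hy, hz, ← map_mul, ← map_mul, ← map_sub,
      Ideal.Quotient.eq_zero_iff_mem]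
    exact Ideal.sub_mem _ (augIdeal_pow_mul_mem (by omega) hyI hzI)
      (augIdeal_pow_mul_mem (by omega) hzI hyI)

theorem isNilpotent (π : Type*) [Group π] [Group.IsNilpotent π] :
    LieRing.IsNilpotent (MalcevLieAlgebra π) := by
  obtain ⟨k, hk⟩ := Subgroup.nilpotent_iff_lowerCentralSeries.mp (inferInstance : Group.IsNilpotent π)
  refine (LieModule.isNilpotent_iff ℂ _ _).mpr ⟨k, ?_⟩
  rw [eq_bot_iff]
  exact fun x hx => eq_zero_of_proj hk (mem_filtration.mp (lowerCentralSeries_le_filtration k hx))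

end MalcevLieAlgebra

end MalcevFinite

/-! ### Cartan calculus on the Chevalley–Eilenberg algebra. -/

section Contraction

open ExteriorAlgebra

variable {n : Type*} [LieRing n] [LieAlgebra ℂ n]

/-- The contraction of `⋀ 𝔫*` with an element of `𝔫`. -/
def contr (x : n) :
    ExteriorAlgebra ℂ (Module.Dual ℂ n) →ₗ[ℂ] ExteriorAlgebra ℂ (Module.Dual ℂ n) :=
  CliffordAlgebra.contractLeft (Module.Dual.eval ℂ n x)

lemma contr_algebraMap (x : n) (r : ℂ) : contr x (algebraMap ℂ _ r) = 0 :=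
  CliffordAlgebra.contractLeft_algebraMap _ _ r

lemma contr_ι (x : n) (f : Module.Dual ℂ n) : contr x (ι ℂ f) = algebraMap ℂ _ (f x) :=
  CliffordAlgebra.contractLeft_ι _ _ f

lemma contr_ι_mul (x : n) (f : Module.Dual ℂ n) (a : ExteriorAlgebra ℂ (Module.Dual ℂ n)) :
    contr x (ι ℂ f * a) = f x • a - ι ℂ f * contr x a :=
  CliffordAlgebra.contractLeft_ι_mul _ _ _

lemma contr_mul (x : n) (a b : ExteriorAlgebra ℂ (Module.Dual ℂ n)) :
    contr x (a * b) = contr x a * b + bar a * contr x b := by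
  induction a using ExteriorAlgebra.induction generalizing b with
  | algebraMap r =>
    rw [contr_algebraMap, zero_mul, zero_add, AlgHom.commutes]
    exact CliffordAlgebra.contractLeft_algebraMap_mul _ _ _
  | ι f =>
    rw [contr_ι_mul, contr_ι, bar_ι, Algebra.smul_def, neg_mul, sub_eq_add_neg]
  | mul a a' ha ha' =>
    rw [mul_assoc, ha, ha', ha, map_mul]
    noncomm_ring
  | add a a' ha ha' =>
    rw [add_mul, map_add, ha, ha', map_add, map_add]
    noncomm_ring

lemma contr_bar (x : n) (a : ExteriorAlgebra ℂ (Module.Dual ℂ n)) :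
    contr x (bar a) = -bar (contr x a) := by
  induction a using ExteriorAlgebra.induction with
  | algebraMap r => rw [AlgHom.commutes, contr_algebraMap, map_zero, neg_zero]
  | ι f => rw [bar_ι, map_neg, contr_ι, AlgHom.commutes]
  | mul a b ha hb =>
    rw [map_mul, contr_mul, contr_mul, map_add, map_mul, map_mul, ha, hb]
    noncomm_ring
  | add a b ha hb => rw [map_add, map_add, map_add, map_add, ha, hb, neg_add]

lemma ι_mul_mem {k : ℕ} (f : Module.Dual ℂ n) {a : ExteriorAlgebra ℂ (Module.Dual ℂ n)}
    (ha : a ∈ ⋀[ℂ]^k (Module.Dual ℂ n)) : ι ℂ f * a ∈ ⋀[ℂ]^(k + 1) (Module.Dual ℂ n) := by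
  have := Submodule.mul_mem_mul (M := LinearMap.range (ι ℂ (M := Module.Dual ℂ n))) ⟨f, rfl⟩ ha
  rwa [exteriorPower, ← pow_succ'] at this

/-- `⋀^(k - 1) 𝔫*`, to be read as `0` for `k = 0`. -/
def extPred (n : Type*) [LieRing n] [LieAlgebra ℂ n] :
    ℕ → Submodule ℂ (ExteriorAlgebra ℂ (Module.Dual ℂ n))
  | 0 => ⊥
  | k + 1 => ⋀[ℂ]^k (Module.Dual ℂ n)

lemma ι_mul_mem_of_mem_extPred {k : ℕ} (f : Module.Dual ℂ n)
    {a : ExteriorAlgebra ℂ (Module.Dual ℂ n)} (ha : a ∈ extPred n k) :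
    ι ℂ f * a ∈ ⋀[ℂ]^k (Module.Dual ℂ n) := by
  cases k with
  | zero =>
    rw [(Submodule.mem_bot ℂ).mp ha, mul_zero]
    exact Submodule.zero_mem _
  | succ k => exact ι_mul_mem f ha

lemma contr_mem (x : n) {k : ℕ} {a : ExteriorAlgebra ℂ (Module.Dual ℂ n)}
    (ha : a ∈ ⋀[ℂ]^k (Module.Dual ℂ n)) : contr x a ∈ extPred n k := by
  induction ha using Submodule.pow_induction_on_left' with
  | algebraMap r => rw [contr_algebraMap]; exact Submodule.zero_mem _
  | add a b i _ _ h h' => rw [map_add]; exact Submodule.add_mem _ h h'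
  | mem_mul m hm i a ha h =>
    obtain ⟨f, rfl⟩ := hm
    rw [contr_ι_mul]
    exact Submodule.sub_mem _ (Submodule.smul_mem _ _ ha) (ι_mul_mem_of_mem_extPred f h)

variable [Module.Finite ℂ n]

lemma ceD_mem_of_mem_extPred {k : ℕ} {a : ExteriorAlgebra ℂ (Module.Dual ℂ n)}
    (ha : a ∈ extPred n k) : ceD n a ∈ ⋀[ℂ]^k (Module.Dual ℂ n) := by
  cases k with
  | zero =>
    rw [(Submodule.mem_bot ℂ).mp ha, map_zero]
    exact Submodule.zero_mem _
  | succ k => exact ceD_mem n k a ha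

lemma contr_bracketDual (x : n) (f : Module.Dual ℂ n) :
    contr x (bracketDual n f) = ι ℂ (-(LieModule.toEnd ℂ n n x).dualMap f) := by
  set b := Module.finBasis ℂ n with hb
  have h1 : ∀ x, (LieModule.toEnd ℂ n n x).dualMap f = ∑ j, f ⁅x, b j⁆ • b.coord j := by
    intro x
    refine b.ext fun k => ?_
    simp [Module.Basis.coord_apply, Finsupp.single_apply, LinearMap.dualMap_apply]
  have h2 : ι ℂ ((LieModule.toEnd ℂ n n x).dualMap f) =
      ∑ i, ∑ j, (f ⁅b i, b j⁆ * b.coord i x) • ι ℂ (b.coord j) := by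
    rw [h1, map_sum, Finset.sum_comm]
    refine Finset.sum_congr rfl fun j _ => ?_
    rw [← Finset.sum_smul, map_smul]
    congr 1
    conv_lhs => rw [← b.sum_repr x]
    simp only [sum_lie, map_sum, smul_lie, map_smul, smul_eq_mul, Module.Basis.coord_apply]
    exact Finset.sum_congr rfl fun i _ => mul_comm _ _
  have h3 : ∑ i, ∑ j, (f ⁅b i, b j⁆ * b.coord j x) • ι ℂ (b.coord i) =
      -ι ℂ ((LieModule.toEnd ℂ n n x).dualMap f) := by
    rw [h2, Finset.sum_comm, ← Finset.sum_neg_distrib]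
    refine Finset.sum_congr rfl fun i _ => ?_
    rw [← Finset.sum_neg_distrib]
    refine Finset.sum_congr rfl fun j _ => ?_
    rw [← lie_skew, map_neg, neg_mul, neg_smul]
  have h4 : contr x (bracketDual n f) = (-(1 / 2 : ℂ)) •
      (∑ i, ∑ j, (f ⁅b i, b j⁆ * b.coord i x) • ι ℂ (b.coord j) -
        ∑ i, ∑ j, (f ⁅b i, b j⁆ * b.coord j x) • ι ℂ (b.coord i)) := by
    rw [bracketDual_apply, ← hb, map_smul, map_sum, ← Finset.sum_sub_distrib]
    congr 1
    refine Finset.sum_congr rfl fun i _ => ?_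
    rw [map_sum, ← Finset.sum_sub_distrib]
    refine Finset.sum_congr rfl fun j _ => ?_
    rw [map_smul, contr_ι_mul, contr_ι, ← Algebra.commutes, ← Algebra.smul_def, smul_sub,
      smul_smul, smul_smul]
  rw [h4, h3, ← h2, map_neg]
  module

/-- The Lie derivative on `⋀ 𝔫*`, given by Cartan's formula. -/
def lieDer (x : n) :
    ExteriorAlgebra ℂ (Module.Dual ℂ n) →ₗ[ℂ] ExteriorAlgebra ℂ (Module.Dual ℂ n) :=
  contr x ∘ₗ ceD n + ceD n ∘ₗ contr x

lemma lieDer_apply (x : n) (a : ExteriorAlgebra ℂ (Module.Dual ℂ n)) :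
    lieDer x a = contr x (ceD n a) + ceD n (contr x a) := rfl

lemma lieDer_algebraMap (x : n) (r : ℂ) : lieDer x (algebraMap ℂ _ r) = 0 := by
  rw [lieDer_apply, ceD_algebraMap, contr_algebraMap, map_zero, map_zero, add_zero]

lemma lieDer_ι (x : n) (f : Module.Dual ℂ n) :
    lieDer x (ι ℂ f) = ι ℂ (-(LieModule.toEnd ℂ n n x).dualMap f) := by
  rw [lieDer_apply, ceD_ι, contr_bracketDual, contr_ι, ceD_algebraMap, add_zero]

/-- The contraction and the differential are odd antiderivations, so in their anticommutator the
cross terms cancel. -/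
lemma lieDer_mul (x : n) (a b : ExteriorAlgebra ℂ (Module.Dual ℂ n)) :
    lieDer x (a * b) = lieDer x a * b + a * lieDer x b := by
  simp only [lieDer_apply, ceD_mul, contr_mul, map_add, contr_bar, ceD_bar,
    CliffordAlgebra.involute_involute]
  noncomm_ring

lemma lieDer_ceD (x : n) (a : ExteriorAlgebra ℂ (Module.Dual ℂ n)) :
    lieDer x (ceD n a) = ceD n (lieDer x a) := by
  rw [lieDer_apply, lieDer_apply, ceD_ceD, map_zero, zero_add, map_add, ceD_ceD, add_zero]

lemma lieDer_mem (x : n) {k : ℕ} {a : ExteriorAlgebra ℂ (Module.Dual ℂ n)}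
    (ha : a ∈ ⋀[ℂ]^k (Module.Dual ℂ n)) : lieDer x a ∈ ⋀[ℂ]^k (Module.Dual ℂ n) :=
  Submodule.add_mem _ (contr_mem x (ceD_mem n k a ha)) (ceD_mem_of_mem_extPred (contr_mem x ha))

lemma lieDer_mem_extPred (x : n) {k : ℕ} {a : ExteriorAlgebra ℂ (Module.Dual ℂ n)}
    (ha : a ∈ extPred n k) : lieDer x a ∈ extPred n k := by
  cases k with
  | zero =>
    rw [(Submodule.mem_bot ℂ).mp ha, map_zero]
    exact Submodule.zero_mem _
  | succ k => exact lieDer_mem x ha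

lemma exteriorPower_eq_bot {k : ℕ} (hk : Module.finrank ℂ n < k) :
    ⋀[ℂ]^k (Module.Dual ℂ n) = ⊥ := by
  rw [← Submodule.finrank_eq_zero (R := ℂ), exteriorPower.finrank_eq, Subspace.dual_finrank_eq,
    Nat.choose_eq_zero_of_lt hk]

instance finite_exteriorAlgebra_dual : Module.Finite ℂ (ExteriorAlgebra ℂ (Module.Dual ℂ n)) := by
  have h : (⨆ i : ℕ, ⋀[ℂ]^i (Module.Dual ℂ n)) = ⊤ :=
    (DirectSum.Decomposition.isInternal
      (fun i : ℕ => ⋀[ℂ]^i (Module.Dual ℂ n))).submodule_iSup_eq_top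
  have h' : (⨆ i : Fin (Module.finrank ℂ n + 1), ⋀[ℂ]^(i : ℕ) (Module.Dual ℂ n)) = ⊤ := by
    rw [eq_top_iff, ← h, iSup_le_iff]
    intro i
    rcases lt_or_ge (Module.finrank ℂ n) i with hi | hi
    · rw [exteriorPower_eq_bot hi]; exact bot_le
    · exact le_iSup (fun i : Fin (Module.finrank ℂ n + 1) => ⋀[ℂ]^(i : ℕ) (Module.Dual ℂ n))
        ⟨i, by omega⟩
  rw [Module.finite_def, ← h']
  exact Submodule.fg_iSup _ fun i => Module.Finite.iff_fg.mp inferInstance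

/-- By the Leibniz rule each application of the derivation uses up one of the `i` steps available
for `a` or one of the `j` for `b`. -/
lemma lieDer_pow_mul_eq_zero (x : n) {i j : ℕ} {a b : ExteriorAlgebra ℂ (Module.Dual ℂ n)}
    (ha : (lieDer x ^ i) a = 0) (hb : (lieDer x ^ j) b = 0) :
    (lieDer x ^ (i + j)) (a * b) = 0 := by
  induction h : i + j generalizing i j a b with
  | zero =>
    obtain ⟨rfl, rfl⟩ : i = 0 ∧ j = 0 := by omega
    rw [show a = 0 from ha, zero_mul, map_zero]
  | succ m ih =>
    rw [pow_succ, Module.End.mul_apply, lieDer_mul, map_add]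
    have h1 : (lieDer x ^ m) (lieDer x a * b) = 0 := by
      cases i with
      | zero => rw [show a = 0 from ha, map_zero, zero_mul, map_zero]
      | succ i => exact ih (by rwa [pow_succ] at ha) hb (by omega)
    have h2 : (lieDer x ^ m) (a * lieDer x b) = 0 := by
      cases j with
      | zero => rw [show b = 0 from hb, map_zero, mul_zero, map_zero]
      | succ j => exact ih ha (by rwa [pow_succ] at hb) (by omega)
    rw [h1, h2, add_zero]

/-- On `𝔫*` the operator is minus the transpose of `ad x`, which is nilpotent. Local nilpotency
passes to products by the Leibniz rule, and is nilpotency because `⋀ 𝔫*` is finite-dimensional. -/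
lemma isNilpotent_lieDer [LieRing.IsNilpotent n] (x : n) : IsNilpotent (lieDer x) := by
  rw [Module.End.isNilpotent_iff_of_finite]
  intro a
  induction a using ExteriorAlgebra.induction with
  | algebraMap r => exact ⟨1, by rw [pow_one, lieDer_algebraMap]⟩
  | ι f =>
    obtain ⟨m, hm⟩ := LieModule.isNilpotent_toEnd_of_isNilpotent ℂ n n x
    have h : ∀ k (f : Module.Dual ℂ n), (lieDer x ^ k) (ι ℂ f) =
        ι ℂ ((-1 : ℂ) ^ k • ((LieModule.toEnd ℂ n n x) ^ k).dualMap f) := by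
      intro k
      induction k with
      | zero =>
        intro f
        rw [pow_zero, pow_zero, pow_zero, one_smul]
        rfl
      | succ k ih =>
        intro f
        rw [pow_succ, Module.End.mul_apply, lieDer_ι, ih, pow_succ' (LieModule.toEnd ℂ n n x)]
        congr 1
        ext y
        simp [LinearMap.dualMap_apply, pow_succ]
    refine ⟨m, ?_⟩
    rw [h, hm, show LinearMap.dualMap (0 : Module.End ℂ n) f = 0 from LinearMap.comp_zero _,
      smul_zero, map_zero]
  | mul a b ha hb =>
    obtain ⟨i, hi⟩ := ha
    obtain ⟨j, hj⟩ := hb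
    exact ⟨i + j, lieDer_pow_mul_eq_zero x hi hj⟩
  | add a b ha hb =>
    obtain ⟨i, hi⟩ := ha
    obtain ⟨j, hj⟩ := hb
    refine ⟨i + j, ?_⟩
    have hi' : (lieDer x ^ (i + j)) a = 0 := by
      rw [add_comm, pow_add, Module.End.mul_apply, hi, map_zero]
    have hj' : (lieDer x ^ (i + j)) b = 0 := by
      rw [pow_add, Module.End.mul_apply, hj, map_zero]
    rw [map_add, hi', hj', add_zero]

end Contraction

/-! ### Kernel and cokernel of a nilpotent operator on a subquotient. -/

section NilpotentStep

variable {R M : Type*} [Ring R] [AddCommGroup M] [Module R M] {L : Module.End R M}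

/-- The last iterate of `c` under `L` outside `B` represents a nonzero kernel element. This will be
used with `Z` the cocycles and `B` the coboundaries. -/
lemma exists_mem_notMem_apply_mem (hL : IsNilpotent L) {Z B : Submodule R M}
    (hZ : ∀ z ∈ Z, L z ∈ Z) {c : M} (hc : c ∈ Z) (hcB : c ∉ B) :
    ∃ c ∈ Z, c ∉ B ∧ L c ∈ B := by
  obtain ⟨m, hm⟩ := hL
  have h : (L ^ m) c ∈ B := by rw [hm]; exact B.zero_mem
  clear hm
  induction m generalizing c with
  | zero => exact absurd h hcB
  | succ m ih =>
    by_cases hLc : L c ∈ B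
    · exact ⟨c, hc, hcB, hLc⟩
    · exact ih (hZ c hc) hLc (by rwa [pow_succ] at h)

/-- As in Nakayama's lemma, `Z ≤ L Z + B` iterates to `Z ≤ L ^ m Z + B`, which is `B` for large `m`.
-/
lemma exists_mem_notMem_map_sup (hL : IsNilpotent L) {Z B : Submodule R M}
    (hB : ∀ b ∈ B, L b ∈ B) (h : ¬ Z ≤ B) : ∃ c ∈ Z, c ∉ Z.map L ⊔ B := by
  by_contra! hcon
  have key : ∀ m, Z ≤ Z.map (L ^ m) ⊔ B := by
    intro m
    induction m with
    | zero => exact le_sup_of_le_left (by rw [pow_zero]; exact fun z hz => ⟨z, hz, rfl⟩)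
    | succ m ih =>
      intro z hz
      obtain ⟨_, ⟨y, hy, rfl⟩, b, hb, rfl⟩ := Submodule.mem_sup.mp (hcon z hz)
      obtain ⟨_, ⟨y', hy', rfl⟩, b', hb', rfl⟩ := Submodule.mem_sup.mp (ih hy)
      rw [map_add, add_assoc]
      exact Submodule.add_mem_sup ⟨y', hy', by rw [pow_succ']; rfl⟩ (B.add_mem (hB b' hb') hb)
  obtain ⟨m, hm⟩ := hL
  have := key m
  rw [hm, Submodule.map_zero, bot_sup_eq] at this
  exact h this

end NilpotentStep

/-! ### Nonvanishing of the cohomology of ideals of a nilpotent Lie algebra. -/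

section Nonvanishing

open ExteriorAlgebra

variable {n : Type*} [LieRing n] [LieAlgebra ℂ n]

/-- The ideal of `⋀ 𝔫*` generated by the functionals that vanish on `p`. -/
def annIdeal (p : Submodule ℂ n) : Submodule ℂ (ExteriorAlgebra ℂ (Module.Dual ℂ n)) :=
  p.dualAnnihilator.map (ι ℂ) * ⊤

lemma ι_mul_mem_annIdeal {p : Submodule ℂ n} {f : Module.Dual ℂ n} (hf : f ∈ p.dualAnnihilator)
    (a : ExteriorAlgebra ℂ (Module.Dual ℂ n)) : ι ℂ f * a ∈ annIdeal p :=
  Submodule.mul_mem_mul ⟨f, hf, rfl⟩ Submodule.mem_top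

lemma annIdeal_induction {p : Submodule ℂ n}
    (S : Submodule ℂ (ExteriorAlgebra ℂ (Module.Dual ℂ n)))
    (h : ∀ f ∈ p.dualAnnihilator, ∀ a, ι ℂ f * a ∈ S)
    {x : ExteriorAlgebra ℂ (Module.Dual ℂ n)} (hx : x ∈ annIdeal p) : x ∈ S := by
  refine Submodule.mul_le.mpr ?_ hx
  rintro _ ⟨f, hf, rfl⟩ a _
  exact h f hf a

lemma annIdeal_mono {p q : Submodule ℂ n} (h : p ≤ q) : annIdeal q ≤ annIdeal p := fun _ hx =>
  annIdeal_induction _ (fun _ hf a =>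
    ι_mul_mem_annIdeal (Submodule.dualAnnihilator_anti h hf) a) hx

lemma annIdeal_top : annIdeal (⊤ : Submodule ℂ n) = ⊥ := by
  rw [annIdeal, Submodule.dualAnnihilator_top, Submodule.map_bot, Submodule.bot_mul]

lemma mul_mem_annIdeal {p : Submodule ℂ n} {x : ExteriorAlgebra ℂ (Module.Dual ℂ n)}
    (hx : x ∈ annIdeal p) (y : ExteriorAlgebra ℂ (Module.Dual ℂ n)) : x * y ∈ annIdeal p := by
  refine annIdeal_induction ((annIdeal p).comap (LinearMap.mulRight ℂ y)) (fun f hf a => ?_) hx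
  change ι ℂ f * a * y ∈ annIdeal p
  rw [mul_assoc]
  exact ι_mul_mem_annIdeal hf _

lemma ι_mul_mem_annIdeal_of_mem {p : Submodule ℂ n} (g : Module.Dual ℂ n)
    {x : ExteriorAlgebra ℂ (Module.Dual ℂ n)} (hx : x ∈ annIdeal p) : ι ℂ g * x ∈ annIdeal p := by
  refine annIdeal_induction ((annIdeal p).comap (LinearMap.mulLeft ℂ (ι ℂ g)))
    (fun f hf a => ?_) hx
  change ι ℂ g * (ι ℂ f * a) ∈ annIdeal p
  rw [← mul_assoc, ι_mul_ι_comm, neg_mul, mul_assoc]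
  exact Submodule.neg_mem _ (ι_mul_mem_annIdeal hf _)

lemma contr_mem_annIdeal {p : Submodule ℂ n} {x : n} (hx : x ∈ p)
    {a : ExteriorAlgebra ℂ (Module.Dual ℂ n)} (ha : a ∈ annIdeal p) : contr x a ∈ annIdeal p := by
  refine annIdeal_induction ((annIdeal p).comap (contr x)) (fun f hf a => ?_) ha
  change contr x (ι ℂ f * a) ∈ annIdeal p
  rw [contr_ι_mul, (Submodule.mem_dualAnnihilator f).mp hf x hx, zero_smul, zero_sub]
  exact Submodule.neg_mem _ (ι_mul_mem_annIdeal hf _)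

/-- If `f` spans the functionals that vanish on `q` modulo those that vanish on `p`, then every
element of the ideal of `q` is one of the ideal of `p` plus a multiple of `f`. -/
lemma exists_eq_add_ι_mul {p q : Submodule ℂ n} {f : Module.Dual ℂ n} {x : n}
    (hfx : f x = 1) (hf : f ∈ q.dualAnnihilator)
    (hpq : p ≤ q ⊔ Submodule.span ℂ {x}) {a : ExteriorAlgebra ℂ (Module.Dual ℂ n)}
    (ha : a ∈ annIdeal q) : ∃ b ∈ annIdeal p, ∃ e, a = b + ι ℂ f * e := by
  have : a ∈ annIdeal p ⊔ LinearMap.range (LinearMap.mulLeft ℂ (ι ℂ f)) := by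
    refine annIdeal_induction _ (fun g hg a => ?_) ha
    have hg' : g - g x • f ∈ p.dualAnnihilator := by
      refine Submodule.dualAnnihilator_anti hpq ?_
      rw [Submodule.dualAnnihilator_sup_eq]
      refine ⟨Submodule.sub_mem _ hg (Submodule.smul_mem _ _ hf), ?_⟩
      rw [SetLike.mem_coe, Submodule.mem_dualAnnihilator]
      intro y hy
      obtain ⟨c, rfl⟩ := Submodule.mem_span_singleton.mp hy
      simp [hfx]
    refine Submodule.mem_sup.mpr ⟨ι ℂ (g - g x • f) * a, ι_mul_mem_annIdeal hg' a,
      ι ℂ f * (g x • a), ⟨_, rfl⟩, ?_⟩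
    rw [map_sub, map_smul, sub_mul, smul_mul_assoc, mul_smul_comm, sub_add_cancel]
  obtain ⟨b, hb, _, ⟨e, rfl⟩, rfl⟩ := Submodule.mem_sup.mp this
  exact ⟨b, hb, e, rfl⟩

lemma ι_mul_mem_annIdeal_of_sup {p q : Submodule ℂ n} {f : Module.Dual ℂ n} {x : n}
    (hfx : f x = 1) (hf : f ∈ q.dualAnnihilator)
    (hpq : p ≤ q ⊔ Submodule.span ℂ {x}) {a : ExteriorAlgebra ℂ (Module.Dual ℂ n)}
    (ha : a ∈ annIdeal q) : ι ℂ f * a ∈ annIdeal p := by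
  obtain ⟨b, hb, e, rfl⟩ := exists_eq_add_ι_mul hfx hf hpq ha
  rw [mul_add, ← mul_assoc, ι_sq_zero, zero_mul, add_zero]
  exact ι_mul_mem_annIdeal_of_mem f hb

/-- If `[𝔫, p] = p`, then `p` would lie in every term of the lower central series. Hence `[𝔫, p]` is
proper in `p` and some functional separates them; its kernel in `p` is again an ideal of `𝔫`. -/
lemma exists_dual_lie_eq_zero [LieRing.IsNilpotent n] (p : LieIdeal ℂ n) (hp : p ≠ ⊥) :
    ∃ f : Module.Dual ℂ n, (∀ x : n, ∀ y ∈ p, f ⁅x, y⁆ = 0) ∧ ∃ x ∈ p, f x = 1 := by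
  have hlt : ¬ p ≤ ⁅(⊤ : LieIdeal ℂ n), p⁆ := by
    intro hle
    obtain ⟨k, hk⟩ := (LieModule.isNilpotent_iff ℂ n n).mp inferInstance
    have : ∀ k, p ≤ LieModule.lowerCentralSeries ℂ n n k := by
      intro k
      induction k with
      | zero => exact le_top
      | succ k ih =>
        rw [LieModule.lowerCentralSeries_succ]
        exact hle.trans (LieSubmodule.mono_lie_right _ ih)
    exact hp (eq_bot_iff.mpr (hk ▸ this k))
  obtain ⟨x, hx, hx'⟩ := SetLike.not_le_iff_exists.mp hlt
  obtain ⟨f, hfx, hf⟩ := Submodule.exists_le_ker_of_notMem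
    (p := (⁅(⊤ : LieIdeal ℂ n), p⁆ : LieIdeal ℂ n).toSubmodule) hx'
  refine ⟨(f x)⁻¹ • f, fun y z hz => ?_, x, hx, ?_⟩
  · rw [LinearMap.smul_apply, show f ⁅y, z⁆ = 0 from hf (LieSubmodule.lie_mem_lie
      (LieSubmodule.mem_top y) hz), smul_zero]
  · rw [LinearMap.smul_apply, smul_eq_mul, inv_mul_cancel₀ hfx]

lemma le_inf_ker_sup_span {p : Submodule ℂ n} {f : Module.Dual ℂ n} {x : n} (hx : x ∈ p)
    (hfx : f x = 1) : p ≤ (p ⊓ LinearMap.ker f) ⊔ Submodule.span ℂ {x} := by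
  intro y hy
  rw [← sub_add_cancel y (f y • x)]
  refine Submodule.add_mem_sup ⟨Submodule.sub_mem _ hy (Submodule.smul_mem _ _ hx), ?_⟩
    (Submodule.smul_mem _ _ (Submodule.mem_span_singleton_self x))
  rw [SetLike.mem_coe, LinearMap.mem_ker]
  simp [hfx]

variable [Module.Finite ℂ n]

/-- For each fixed `j`, the sum over `i` collects into the functional `y ↦ f ⁅y, b j⁆`, which
vanishes on `p`. So `f` is closed as a cochain of `p`. -/
lemma bracketDual_mem_annIdeal {p : Submodule ℂ n} {f : Module.Dual ℂ n}
    (hf : ∀ x : n, ∀ y ∈ p, f ⁅x, y⁆ = 0) : bracketDual n f ∈ annIdeal p := by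
  rw [bracketDual_apply]
  set b := Module.finBasis ℂ n
  refine Submodule.smul_mem _ _ ?_
  rw [Finset.sum_comm]
  refine Submodule.sum_mem _ fun j _ => ?_
  have h : (LieModule.toEnd ℂ n n (b j)).dualMap f = -∑ i, f ⁅b i, b j⁆ • b.coord i := by
    refine b.ext fun k => ?_
    rw [LinearMap.dualMap_apply, LieModule.toEnd_apply_apply, ← lie_skew, map_neg]
    simp [Module.Basis.coord_apply, Finsupp.single_apply]
  have h' : ∑ i, f ⁅b i, b j⁆ • (ι ℂ (b.coord i) * ι ℂ (b.coord j)) =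
      ι ℂ (-(LieModule.toEnd ℂ n n (b j)).dualMap f) * ι ℂ (b.coord j) := by
    rw [h, neg_neg, map_sum, Finset.sum_mul]
    exact Finset.sum_congr rfl fun i _ => by rw [map_smul, smul_mul_assoc]
  rw [h']
  refine ι_mul_mem_annIdeal (Submodule.neg_mem _ ?_) _
  rw [Submodule.mem_dualAnnihilator]
  exact fun y hy => hf _ y hy

lemma lieDer_mem_annIdeal {p : Submodule ℂ n} (hp : ∀ x : n, ∀ y ∈ p, ⁅x, y⁆ ∈ p) (x : n)
    {a : ExteriorAlgebra ℂ (Module.Dual ℂ n)} (ha : a ∈ annIdeal p) :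
    lieDer x a ∈ annIdeal p := by
  refine annIdeal_induction ((annIdeal p).comap (lieDer x)) (fun f hf a => ?_) ha
  change lieDer x (ι ℂ f * a) ∈ annIdeal p
  rw [lieDer_mul, lieDer_ι]
  refine Submodule.add_mem _ (ι_mul_mem_annIdeal (Submodule.neg_mem _ ?_) _)
    (ι_mul_mem_annIdeal hf _)
  rw [Submodule.mem_dualAnnihilator]
  exact fun y hy => (Submodule.mem_dualAnnihilator f).mp hf _ (hp x y hy)

/-- The degree `k` cochains that are cocycles modulo the ideal of `p`. -/
def relCocycles (p : Submodule ℂ n) (k : ℕ) :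
    Submodule ℂ (ExteriorAlgebra ℂ (Module.Dual ℂ n)) :=
  ⋀[ℂ]^k (Module.Dual ℂ n) ⊓ (annIdeal p).comap (ceD n)

/-- The degree `k` coboundaries, plus the ideal of `p`. -/
def relCoboundaries (p : Submodule ℂ n) (k : ℕ) :
    Submodule ℂ (ExteriorAlgebra ℂ (Module.Dual ℂ n)) :=
  (extPred n k).map (ceD n) ⊔ annIdeal p

lemma relCoboundaries_mono {p q : Submodule ℂ n} (h : p ≤ q) (k : ℕ) :
    relCoboundaries q k ≤ relCoboundaries p k :=
  sup_le_sup_left (annIdeal_mono h) _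

lemma lieDer_mem_relCocycles {p : Submodule ℂ n} (hp : ∀ x : n, ∀ y ∈ p, ⁅x, y⁆ ∈ p) (x : n) {k : ℕ}
    {a : ExteriorAlgebra ℂ (Module.Dual ℂ n)} (ha : a ∈ relCocycles p k) :
    lieDer x a ∈ relCocycles p k := by
  refine ⟨lieDer_mem x ha.1, ?_⟩
  change ceD n (lieDer x a) ∈ annIdeal p
  rw [← lieDer_ceD]
  exact lieDer_mem_annIdeal hp x ha.2

lemma lieDer_mem_relCoboundaries {p : Submodule ℂ n} (hp : ∀ x : n, ∀ y ∈ p, ⁅x, y⁆ ∈ p) (x : n)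
    {k : ℕ} {a : ExteriorAlgebra ℂ (Module.Dual ℂ n)} (ha : a ∈ relCoboundaries p k) :
    lieDer x a ∈ relCoboundaries p k := by
  obtain ⟨_, ⟨b, hb, rfl⟩, c, hc, rfl⟩ := Submodule.mem_sup.mp ha
  rw [map_add, lieDer_ceD]
  exact Submodule.add_mem_sup ⟨_, lieDer_mem_extPred x hb, rfl⟩ (lieDer_mem_annIdeal hp x hc)

lemma finrank_inf_ker {p : Submodule ℂ n} {f : Module.Dual ℂ n} {x : n} (hx : x ∈ p)
    (hfx : f x = 1) :
    Module.finrank ℂ (p ⊓ LinearMap.ker f : Submodule ℂ n) + 1 = Module.finrank ℂ p := by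
  have hlt : (p ⊓ LinearMap.ker f : Submodule ℂ n) < p := by
    refine lt_of_le_of_ne inf_le_left fun h => ?_
    have : f x = 0 := (h.ge hx).2
    rw [hfx] at this
    exact one_ne_zero this
  have h1 := Submodule.finrank_lt_finrank_of_lt hlt
  have h2 := Submodule.finrank_mono (le_inf_ker_sup_span hx hfx)
  have h3 := Submodule.finrank_add_le_finrank_add_finrank (p ⊓ LinearMap.ker f)
    (Submodule.span ℂ {x})
  have h4 := finrank_span_le_card (R := ℂ) ({x} : Set n)
  simp only [Set.toFinset_singleton, Finset.card_singleton] at h4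
  omega

section Step

variable [LieRing.IsNilpotent n] {p q : Submodule ℂ n} {f : Module.Dual ℂ n} {x : n}

/-- Classes of `q` lift to classes of `p`. -/
lemma exists_relCocycle_lift (hqp : q ≤ p) (hpq : p ≤ q ⊔ Submodule.span ℂ {x})
    (hlie : ∀ x : n, ∀ y ∈ p, ⁅x, y⁆ ∈ q) (hf : f ∈ q.dualAnnihilator) (hx : x ∈ p)
    (hfx : f x = 1) {k : ℕ} (hk : ¬ relCocycles q k ≤ relCoboundaries q k) :
    ∃ c ∈ relCocycles p k, c ∉ relCoboundaries q k := by
  have hq : ∀ x : n, ∀ y ∈ q, ⁅x, y⁆ ∈ q := fun x y hy => hlie x y (hqp hy)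
  obtain ⟨c, hcZ, hcB⟩ := SetLike.not_le_iff_exists.mp hk
  obtain ⟨c, ⟨hcA, hdc⟩, hcB, hLc⟩ := exists_mem_notMem_apply_mem (isNilpotent_lieDer x)
    (fun z hz => lieDer_mem_relCocycles hq x hz) hcZ hcB
  obtain ⟨κ, hκ, e, he⟩ := exists_eq_add_ι_mul hfx hf hpq hdc
  obtain ⟨_, ⟨b₀, hb₀, rfl⟩, κ₀, hκ₀, hL⟩ := Submodule.mem_sup.mp hLc
  have hic : contr x c ∈ extPred n k := contr_mem x hcA
  -- Write `d c = κ + f e`. Contracting with `x` and using `L_x c = d b₀ + κ₀` shows that `e` equals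
  -- `d b` modulo the ideal of `q`, so adding `f b` to `c` cancels `f e` modulo the ideal of `p` and
  -- does not change `c` modulo that of `q`.
  set b := b₀ - contr x c with hb
  have hbmem : b ∈ extPred n k := Submodule.sub_mem _ hb₀ hic
  have he' : e - ceD n b ∈ annIdeal q := by
    have h1 : contr x (ceD n c) = contr x κ + (e - ι ℂ f * contr x e) := by
      rw [he, map_add, contr_ι_mul, hfx, one_smul]
    have h2 : e - ceD n b = κ₀ - contr x κ + ι ℂ f * contr x e := by
      rw [lieDer_apply, h1] at hL
      have h3 : κ₀ = contr x κ + (e - ι ℂ f * contr x e) + ceD n (contr x c) - ceD n b₀ := by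
        rw [← hL]; abel
      rw [h3, hb, map_sub]
      abel
    rw [h2]
    exact Submodule.add_mem _ (Submodule.sub_mem _ hκ₀ (annIdeal_mono hqp
      (contr_mem_annIdeal hx hκ))) (ι_mul_mem_annIdeal hf _)
  refine ⟨c + ι ℂ f * b, ⟨Submodule.add_mem _ hcA (ι_mul_mem_of_mem_extPred f hbmem), ?_⟩, ?_⟩
  · change ceD n _ ∈ annIdeal p
    have : ceD n (c + ι ℂ f * b) = κ + ι ℂ f * (e - ceD n b) + bracketDual n f * b := by
      rw [map_add, he, ceD_mul, ceD_ι, bar_ι]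
      noncomm_ring
    rw [this]
    refine Submodule.add_mem _ (Submodule.add_mem _ hκ (ι_mul_mem_annIdeal_of_sup hfx hf hpq he'))
      (mul_mem_annIdeal (bracketDual_mem_annIdeal fun x y hy => ?_) _)
    exact (Submodule.mem_dualAnnihilator f).mp hf _ (hlie x y hy)
  · intro h
    refine hcB ?_
    rw [← add_sub_cancel_right c (ι ℂ f * b)]
    exact Submodule.sub_mem _ h (Submodule.mem_sup_right (ι_mul_mem_annIdeal hf _))

/-- Multiplication by `f` carries some class of `q` to a nonzero class of `p`. -/
lemma exists_ι_mul_notMem_relCoboundaries (hqp : q ≤ p) (hpq : p ≤ q ⊔ Submodule.span ℂ {x})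
    (hlie : ∀ x : n, ∀ y ∈ p, ⁅x, y⁆ ∈ q) (hf : f ∈ q.dualAnnihilator) (hx : x ∈ p)
    (hfx : f x = 1) {k : ℕ} (hk : ¬ relCocycles q k ≤ relCoboundaries q k) :
    ∃ c, ι ℂ f * c ∈ relCocycles p (k + 1) ∧ ι ℂ f * c ∉ relCoboundaries p (k + 1) := by
  have hq : ∀ x : n, ∀ y ∈ q, ⁅x, y⁆ ∈ q := fun x y hy => hlie x y (hqp hy)
  obtain ⟨c, ⟨hcA, hdc⟩, hcB⟩ := exists_mem_notMem_map_sup (isNilpotent_lieDer x)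
    (fun b hb => lieDer_mem_relCoboundaries hq x hb) hk
  refine ⟨c, ⟨ι_mul_mem f hcA, ?_⟩, fun h => hcB ?_⟩
  · change ceD n _ ∈ annIdeal p
    rw [ceD_mul, ceD_ι, bar_ι, neg_mul]
    refine Submodule.add_mem _ (mul_mem_annIdeal (bracketDual_mem_annIdeal fun x y hy => ?_) _)
      (Submodule.neg_mem _ (ι_mul_mem_annIdeal_of_sup hfx hf hpq hdc))
    exact (Submodule.mem_dualAnnihilator f).mp hf _ (hlie x y hy)
  · obtain ⟨_, ⟨y, hy, rfl⟩, κ, hκ, hyκ⟩ := Submodule.mem_sup.mp h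
    -- If `f c = d y + κ`, contracting with `x` exhibits `c` as `L_x y` plus a coboundary modulo the
    -- ideal of `q`. Since `y` is a cocycle on `q`, this contradicts the choice of `c` outside the
    -- image of `L_x`.
    have h1 : contr x (ceD n y) + contr x κ = c - ι ℂ f * contr x c := by
      rw [← map_add, hyκ, contr_ι_mul, hfx, one_smul]
    have h2 : c = lieDer x y + (ceD n (-contr x y) + (contr x κ + ι ℂ f * contr x c)) := by
      calc c = (contr x (ceD n y) + contr x κ) + ι ℂ f * contr x c := by rw [h1]; abel
        _ = _ := by rw [lieDer_apply, map_neg]; abel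
    rw [h2]
    refine Submodule.add_mem_sup ⟨y, ⟨hy, ?_⟩, rfl⟩ (Submodule.add_mem_sup
      ⟨_, Submodule.neg_mem _ (contr_mem x hy), rfl⟩ (Submodule.add_mem _
        (annIdeal_mono hqp (contr_mem_annIdeal hx hκ)) (ι_mul_mem_annIdeal hf _)))
    change ceD n y ∈ annIdeal q
    rw [eq_sub_of_add_eq hyκ]
    exact Submodule.sub_mem _ (ι_mul_mem_annIdeal hf _) (annIdeal_mono hqp hκ)

end Step

section Existence

variable [LieRing.IsNilpotent n]

/-- The cohomology of a nilpotent Lie algebra `p` is nonzero in all degrees up to the dimension. -/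
theorem not_relCocycles_le_relCoboundaries (p : LieIdeal ℂ n) {k : ℕ}
    (hk : k ≤ Module.finrank ℂ p) :
    ¬ relCocycles p.toSubmodule k ≤ relCoboundaries p.toSubmodule k := by
  induction hm : Module.finrank ℂ p generalizing p k with
  | zero =>
    obtain rfl : k = 0 := by omega
    have h1 : (1 : ExteriorAlgebra ℂ (Module.Dual ℂ n)) ∈ relCocycles p.toSubmodule 0 := by
      refine ⟨?_, ?_⟩
      · rw [exteriorPower, pow_zero]; exact Submodule.one_le.mp le_rfl
      · change ceD n 1 ∈ annIdeal p.toSubmodule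
        rw [← map_one (algebraMap ℂ _), ceD_algebraMap]
        exact Submodule.zero_mem _
    intro hle
    have h2 := hle h1
    rw [relCoboundaries, extPred, Submodule.map_bot, bot_sup_eq] at h2
    have h3 := annIdeal_induction (LinearMap.ker
      -- The projection to degree zero kills the ideal but not `1`.
      (algebraMapInv (R := ℂ) (M := Module.Dual ℂ n)).toLinearMap) (fun f _ a => by
        simp [algebraMapInv]) h2
    rw [LinearMap.mem_ker, AlgHom.toLinearMap_apply, map_one] at h3
    exact one_ne_zero h3
  | succ m ih =>
    have hp : p ≠ ⊥ := by
      rintro rfl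
      rw [show Module.finrank ℂ (⊥ : LieIdeal ℂ n) = 0 from finrank_bot ℂ n] at hm
      omega
    obtain ⟨f, hf, x, hx, hfx⟩ := exists_dual_lie_eq_zero p hp
    let q : LieIdeal ℂ n :=
      { toSubmodule := p.toSubmodule ⊓ LinearMap.ker f
        lie_mem := fun {x y} hy => ⟨p.lie_mem hy.1, hf x y hy.1⟩ }
    have hqf : Module.finrank ℂ q + 1 = Module.finrank ℂ p :=
      finrank_inf_ker (p := p.toSubmodule) hx hfx
    have hfq : f ∈ q.toSubmodule.dualAnnihilator := by
      rw [Submodule.mem_dualAnnihilator]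
      exact fun y hy => hy.2
    have hlie : ∀ x : n, ∀ y ∈ p.toSubmodule, ⁅x, y⁆ ∈ q.toSubmodule :=
      fun x y hy => ⟨p.lie_mem hy, hf x y hy⟩
    rcases Nat.lt_or_ge m k with h | h
    -- The top degree of `p` exceeds the dimension `m` of `q`, so its class must come from
    -- multiplication by `f`; all lower degrees are reached by lifting from `q`.
    · obtain rfl : k = m + 1 := by omega
      obtain ⟨c, hc, hc'⟩ := exists_ι_mul_notMem_relCoboundaries (p := p.toSubmodule)
        (q := q.toSubmodule) inf_le_left (le_inf_ker_sup_span hx hfx) hlie hfq hx hfx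
        (ih q (k := m) (by omega) (by omega))
      exact fun hle => hc' (hle hc)
    · obtain ⟨c, hc, hc'⟩ := exists_relCocycle_lift (p := p.toSubmodule)
        (q := q.toSubmodule) inf_le_left (le_inf_ker_sup_span hx hfx) hlie hfq hx hfx
        (ih q (k := k) (by omega) (by omega))
      exact fun hle => hc' (relCoboundaries_mono inf_le_left k (hle hc))

end Existence

end Nonvanishing

/-! ### Homogeneous parts of a tensor product. -/

section TensorDegree

variable {M W : Type*} [AddCommGroup M] [Module ℂ M] [AddCommGroup W] [Module ℂ W]

/-- The image of `p ⊗ W` in `M ⊗ W`. -/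
def tensorSub (p : Submodule ℂ M) (W : Type*) [AddCommGroup W] [Module ℂ W] :
    Submodule ℂ (M ⊗[ℂ] W) :=
  LinearMap.range (p.subtype.rTensor W)

lemma tmul_mem_tensorSub {p : Submodule ℂ M} {a : M} (ha : a ∈ p) (w : W) :
    a ⊗ₜ w ∈ tensorSub p W :=
  ⟨⟨a, ha⟩ ⊗ₜ w, rfl⟩

lemma tensorSub_induction {p : Submodule ℂ M} {q : M ⊗[ℂ] W → Prop}
    (tmul : ∀ a ∈ p, ∀ w : W, q (a ⊗ₜ w)) (add : ∀ x y, q x → q y → q (x + y))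
    {t : M ⊗[ℂ] W} (ht : t ∈ tensorSub p W) : q t := by
  obtain ⟨t, rfl⟩ := ht
  induction t using TensorProduct.induction_on with
  | zero => simpa using tmul 0 (Submodule.zero_mem _) 0
  | tmul a w => exact tmul a a.2 w
  | add x y hx hy => rw [map_add]; exact add _ _ hx hy

lemma tensorSub_bot : tensorSub (⊥ : Submodule ℂ M) W = ⊥ := by
  rw [eq_bot_iff]
  intro t ht
  refine tensorSub_induction (q := fun t => t ∈ (⊥ : Submodule ℂ (M ⊗[ℂ] W)))
    (fun a ha w => ?_) (fun x y => Submodule.add_mem _) ht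
  rw [(Submodule.mem_bot ℂ).mp ha, TensorProduct.zero_tmul]
  exact Submodule.zero_mem _

end TensorDegree

/-! ### Nilpotent Lie algebras of traceless `2 × 2` matrices. -/

section Traceless

/-- The entries of the commutator are the `2 × 2` minors of the coordinate vectors of `m` and `z` in
the traceless matrices, up to constants, so its vanishing is proportionality. The cases look for a
nonzero entry of `z` to divide by. -/
lemma exists_smul_eq_of_commute {m z : Matrix (Fin 2) (Fin 2) ℂ} (hm : m.trace = 0)
    (hz : z.trace = 0) (hz0 : z ≠ 0) (h : m * z = z * m) : ∃ c : ℂ, m = c • z := by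
  rw [Matrix.trace_fin_two] at hm hz
  have hm' : m 1 1 = -m 0 0 := by linear_combination hm
  have hz' : z 1 1 = -z 0 0 := by linear_combination hz
  have h00 := congrFun (congrFun h 0) 0
  have h01 := congrFun (congrFun h 0) 1
  have h10 := congrFun (congrFun h 1) 0
  simp only [Matrix.mul_apply, Fin.sum_univ_two, hm', hz'] at h00 h01 h10
  by_cases ha : z 0 0 = 0
  · by_cases hb : z 0 1 = 0
    · by_cases hc : z 1 0 = 0
      · refine absurd ?_ hz0
        ext i j
        fin_cases i <;> fin_cases j <;> simp [ha, hb, hc, hz']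
      · have e1 : m 0 0 = 0 := by
          have : m 0 0 * z 1 0 = 0 := by
            rw [ha] at h10; linear_combination (-1 / 2) * h10
          exact (mul_eq_zero.mp this).resolve_right hc
        have e2 : m 0 1 = 0 := by
          have : m 0 1 * z 1 0 = 0 := by
            rw [hb] at h00; linear_combination h00
          exact (mul_eq_zero.mp this).resolve_right hc
        refine ⟨m 1 0 / z 1 0, ?_⟩
        ext i j
        fin_cases i <;> fin_cases j <;> simp [ha, hb, hc, hz', hm', e1, e2]
    · have e1 : m 0 0 = 0 := by
        have : m 0 0 * z 0 1 = 0 := by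
          rw [ha] at h01; linear_combination (1 / 2) * h01
        exact (mul_eq_zero.mp this).resolve_right hb
      refine ⟨m 0 1 / z 0 1, ?_⟩
      have e2 : m 1 0 = m 0 1 / z 0 1 * z 1 0 := by
        field_simp
        linear_combination -h00
      ext i j
      fin_cases i <;> fin_cases j <;> simp [ha, hb, hz', hm', e1, ← e2]
  · refine ⟨m 0 0 / z 0 0, ?_⟩
    have e1 : m 0 1 = m 0 0 / z 0 0 * z 0 1 := by
      field_simp
      linear_combination (-1 / 2) * h01
    have e2 : m 1 0 = m 0 0 / z 0 0 * z 1 0 := by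
      field_simp
      linear_combination (1 / 2) * h10
    ext i j
    fin_cases i <;> fin_cases j <;> simp [ha, hz', hm', ← e1, ← e2]

/-- A homomorphism from a nilpotent Lie algebra to a Lie algebra of traceless `2 × 2` matrices has
rank at most one. -/
lemma exists_eq_smul_of_isNilpotent {n : Type*} [LieRing n] [LieAlgebra ℂ n]
    [LieRing.IsNilpotent n] {𝔤 : LieSubalgebra ℂ (Matrix (Fin 2) (Fin 2) ℂ)}
    (h𝔤 : ∀ a ∈ 𝔤, a.trace = 0) (ρ : n →ₗ⁅ℂ⁆ 𝔤) :
    ∃ (η : Module.Dual ℂ n) (z : 𝔤), ∀ x, ρ x = η x • z := by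
  by_cases hρ : ∀ x, ρ x = 0
  · exact ⟨0, 0, fun x => by rw [hρ, smul_zero]⟩
  push Not at hρ
  obtain ⟨y, hy⟩ := hρ
  have := ρ.isNilpotent_range
  have : Nontrivial ρ.range :=
    ⟨⟨⟨ρ y, y, rfl⟩, 0, fun h => hy (congrArg Subtype.val h)⟩⟩
  have := LieAlgebra.non_trivial_center_of_isNilpotent (R := ℂ) (L := ρ.range)
  obtain ⟨⟨⟨z, hzr⟩, hzc⟩, hz⟩ := exists_ne (0 : LieAlgebra.center ℂ ρ.range)
  have hz0 : z ≠ 0 := fun h => hz (Subtype.ext (Subtype.ext h))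
  have hcomm : ∀ x, ⁅ρ x, z⁆ = 0 := fun x =>
    congrArg Subtype.val ((LieModule.mem_maxTrivSubmodule ℂ ρ.range ρ.range _).mp hzc ⟨ρ x, x, rfl⟩)
  have hsmul : ∀ x, ∃ c : ℂ, ρ x = c • z := by
    intro x
    have h1 : (ρ x : Matrix (Fin 2) (Fin 2) ℂ) * z - z * ρ x = 0 :=
      congrArg Subtype.val (hcomm x)
    obtain ⟨c, hc⟩ := exists_smul_eq_of_commute (h𝔤 _ (ρ x).2) (h𝔤 _ z.2)
      (fun h => hz0 (Subtype.ext h)) (sub_eq_zero.mp h1)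
    exact ⟨c, Subtype.ext hc⟩
  -- A functional that does not vanish at `z` reads off the scalars, which makes them linear in `x`.
  obtain ⟨φ, hφ, -⟩ := Submodule.exists_le_ker_of_notMem (p := (⊥ : Submodule ℂ 𝔤)) hz0
  refine ⟨(φ z)⁻¹ • φ.comp ρ.toLinearMap, z, fun x => ?_⟩
  obtain ⟨c, hc⟩ := hsmul x
  rw [LinearMap.smul_apply, LinearMap.comp_apply]
  change ρ x = ((φ z)⁻¹ • φ (ρ x)) • z
  rw [hc, map_smul, smul_eq_mul, smul_eq_mul, mul_comm c, inv_mul_cancel_left₀ hφ]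

end Traceless

/-! ### Flat connections as Lie algebra homomorphisms. -/

section FlatConnections

open ExteriorAlgebra

variable {n : Type*} [LieRing n] [LieAlgebra ℂ n]

/-- Evaluation of the degree one part of a cochain. -/
def evalOne (x : n) : ExteriorAlgebra ℂ (Module.Dual ℂ n) →ₗ[ℂ] ℂ :=
  algebraMapInv.toLinearMap.comp (contr x)

/-- Evaluation of the degree two part of a cochain. -/
def evalTwo (x y : n) : ExteriorAlgebra ℂ (Module.Dual ℂ n) →ₗ[ℂ] ℂ :=
  (evalOne y).comp (contr x)

lemma evalOne_ι (x : n) (f : Module.Dual ℂ n) : evalOne x (ι ℂ f) = f x := by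
  rw [evalOne, LinearMap.comp_apply, contr_ι, AlgHom.toLinearMap_apply, AlgHom.commutes]
  rfl

lemma evalOne_add (x y : n) : evalOne (x + y) = evalOne x + evalOne y := by
  ext a
  simp [evalOne, contr]

lemma evalOne_smul (c : ℂ) (x : n) : evalOne (c • x) = c • evalOne x := by
  ext a
  simp [evalOne, contr]

lemma evalTwo_ι_mul_ι (x y : n) (f g : Module.Dual ℂ n) :
    evalTwo x y (ι ℂ f * ι ℂ g) = f x * g y - f y * g x := by
  rw [evalTwo, LinearMap.comp_apply, contr_ι_mul, contr_ι, map_sub, map_smul, evalOne_ι,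
    ← Algebra.commutes, ← Algebra.smul_def, map_smul, evalOne_ι, smul_eq_mul, smul_eq_mul,
    mul_comm (g x)]

variable {W : Type*} [AddCommGroup W] [Module ℂ W]

/-- Apply a linear functional to the first factor of a tensor product. -/
def evalLeft {M : Type*} [AddCommGroup M] [Module ℂ M] (φ : Module.Dual ℂ M) : M ⊗[ℂ] W →ₗ[ℂ] W :=
  (TensorProduct.lid ℂ W).toLinearMap.comp (φ.rTensor W)

section

variable {M : Type*} [AddCommGroup M] [Module ℂ M]

lemma evalLeft_tmul (φ : Module.Dual ℂ M) (a : M) (w : W) : evalLeft φ (a ⊗ₜ[ℂ] w) = φ a • w := rfl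

lemma evalLeft_add (φ ψ : Module.Dual ℂ M) (t : M ⊗[ℂ] W) :
    evalLeft (φ + ψ) t = evalLeft φ t + evalLeft ψ t := by
  rw [evalLeft, LinearMap.rTensor_add, LinearMap.comp_add]
  rfl

lemma evalLeft_smul (c : ℂ) (φ : Module.Dual ℂ M) (t : M ⊗[ℂ] W) :
    evalLeft (c • φ) t = c • evalLeft φ t := by
  rw [evalLeft, LinearMap.rTensor_smul, LinearMap.comp_smul]
  rfl

end

lemma exists_ι_eq_of_mem {a : ExteriorAlgebra ℂ (Module.Dual ℂ n)}
    (ha : a ∈ ⋀[ℂ]^1 (Module.Dual ℂ n)) : ∃ f : Module.Dual ℂ n, ι ℂ f = a := by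
  rwa [exteriorPower, pow_one] at ha

lemma ι_mem_exteriorPower_one (f : Module.Dual ℂ n) : ι ℂ f ∈ ⋀[ℂ]^1 (Module.Dual ℂ n) := by
  rw [exteriorPower, pow_one]
  exact ⟨f, rfl⟩

variable {𝔤 : Type*} [LieRing 𝔤] [LieAlgebra ℂ 𝔤]

/-- The bracket of `⋀ 𝔫* ⊗ 𝔤`. -/
def extBracket (n 𝔤 : Type*) [LieRing n] [LieAlgebra ℂ n] [LieRing 𝔤] [LieAlgebra ℂ 𝔤] :
    ExteriorAlgebra ℂ (Module.Dual ℂ n) ⊗[ℂ] 𝔤 →ₗ[ℂ]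
      ExteriorAlgebra ℂ (Module.Dual ℂ n) ⊗[ℂ] 𝔤 →ₗ[ℂ]
      ExteriorAlgebra ℂ (Module.Dual ℂ n) ⊗[ℂ] 𝔤 :=
  TensorProduct.map₂ (LinearMap.mul ℂ _) (LieModule.toEnd ℂ 𝔤 𝔤).toLinearMap

lemma extBracket_tmul (a b : ExteriorAlgebra ℂ (Module.Dual ℂ n)) (x y : 𝔤) :
    extBracket n 𝔤 (a ⊗ₜ x) (b ⊗ₜ y) = (a * b) ⊗ₜ ⁅x, y⁆ := rfl

/-- For `ω' = ω` the right-hand side is twice the bracket of the two values of `ω`, which cancels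
the factor `½` of the Maurer–Cartan equation. -/
lemma evalLeft_evalTwo_bracket (x y : n) {ω ω' : ExteriorAlgebra ℂ (Module.Dual ℂ n) ⊗[ℂ] 𝔤}
    (hω : ω ∈ tensorSub (⋀[ℂ]^1 (Module.Dual ℂ n)) 𝔤)
    (hω' : ω' ∈ tensorSub (⋀[ℂ]^1 (Module.Dual ℂ n)) 𝔤) :
    evalLeft (evalTwo x y) (extBracket n 𝔤 ω ω') =
      ⁅evalLeft (evalOne x) ω, evalLeft (evalOne y) ω'⁆ -
        ⁅evalLeft (evalOne y) ω, evalLeft (evalOne x) ω'⁆ := by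
  refine tensorSub_induction (q := fun ω => evalLeft (evalTwo x y)
    (extBracket n 𝔤 ω ω') = ⁅evalLeft (evalOne x) ω, evalLeft (evalOne y) ω'⁆ -
      ⁅evalLeft (evalOne y) ω, evalLeft (evalOne x) ω'⁆) (fun a ha w => ?_)
    (fun u v hu hv => ?_) hω
  · refine tensorSub_induction (q := fun ω' => evalLeft (evalTwo x y)
      (extBracket n 𝔤 (a ⊗ₜ w) ω') =
      ⁅evalLeft (evalOne x) (a ⊗ₜ w), evalLeft (evalOne y) ω'⁆ -
        ⁅evalLeft (evalOne y) (a ⊗ₜ w), evalLeft (evalOne x) ω'⁆) (fun a' ha' w' => ?_)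
      (fun u v hu hv => ?_) hω'
    · obtain ⟨f, rfl⟩ := exists_ι_eq_of_mem ha
      obtain ⟨g, rfl⟩ := exists_ι_eq_of_mem ha'
      simp only [extBracket_tmul, evalLeft_tmul, evalTwo_ι_mul_ι, evalOne_ι, smul_lie, lie_smul]
      module
    · simp only [map_add, hu, hv, lie_add]
      abel
  · simp only [map_add, LinearMap.add_apply, hu, hv, add_lie]
    abel

variable [Module.Finite ℂ n]

lemma evalTwo_bracketDual (x y : n) (f : Module.Dual ℂ n) :
    evalTwo x y (bracketDual n f) = -f ⁅x, y⁆ := by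
  rw [evalTwo, LinearMap.comp_apply, contr_bracketDual, evalOne_ι]
  rfl

lemma bracketDual_eq_zero_iff {f : Module.Dual ℂ n} :
    bracketDual n f = 0 ↔ ∀ x y : n, f ⁅x, y⁆ = 0 := by
  refine ⟨fun h x y => ?_, fun h => ?_⟩
  · rw [← neg_eq_zero, ← evalTwo_bracketDual, h, map_zero]
  · rw [bracketDual_apply]
    simp [h]

lemma ι_mem_Z1_iff {f : Module.Dual ℂ n} :
    ι ℂ f ∈ (cochainAlgebra n).Z1 ↔ ∀ x y : n, f ⁅x, y⁆ = 0 := by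
  rw [← bracketDual_eq_zero_iff, ← ceD_ι]
  exact ⟨fun h => h.2, fun h => ⟨ι_mem_exteriorPower_one f, h⟩⟩

lemma evalLeft_evalTwo_ceD (x y : n) {ω : ExteriorAlgebra ℂ (Module.Dual ℂ n) ⊗[ℂ] W}
    (hω : ω ∈ tensorSub (⋀[ℂ]^1 (Module.Dual ℂ n)) W) :
    evalLeft (evalTwo x y) ((ceD n).rTensor W ω) = -evalLeft (evalOne ⁅x, y⁆) ω := by
  refine tensorSub_induction (q := fun ω => evalLeft (evalTwo x y)
    ((ceD n).rTensor W ω) = -evalLeft (evalOne ⁅x, y⁆) ω) (fun a ha w => ?_)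
    (fun u v hu hv => ?_) hω
  · obtain ⟨f, rfl⟩ := exists_ι_eq_of_mem ha
    rw [LinearMap.rTensor_tmul, evalLeft_tmul, evalLeft_tmul, ceD_ι, evalTwo_bracketDual,
      evalOne_ι, neg_smul]
  · rw [map_add, map_add, map_add, hu, hv, neg_add]

lemma eq_sum_smul_coord (f : Module.Dual ℂ n) :
    f = ∑ i, f (Module.finBasis ℂ n i) • (Module.finBasis ℂ n).coord i := by
  refine (Module.finBasis ℂ n).ext fun k => ?_
  rw [LinearMap.sum_apply, Finset.sum_eq_single k]
  · simp
  · intro i _ hik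
    simp [hik.symm]
  · simp

lemma ι_tmul_eq_sum (f : Module.Dual ℂ n) (w : W) :
    ι ℂ f ⊗ₜ[ℂ] w = ∑ i, ι ℂ ((Module.finBasis ℂ n).coord i) ⊗ₜ[ℂ]
      (f (Module.finBasis ℂ n i) • w) := by
  conv_lhs => rw [eq_sum_smul_coord f, map_sum, TensorProduct.sum_tmul]
  exact Finset.sum_congr rfl fun i _ => by rw [map_smul, TensorProduct.smul_tmul]

/-- This recovers `ω` from its values on `𝔫`, so that a formula for the associated homomorphism
becomes a formula for `ω`. -/
lemma eq_sum_ι_coord_tmul_evalLeft {ω : ExteriorAlgebra ℂ (Module.Dual ℂ n) ⊗[ℂ] W}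
    (hω : ω ∈ tensorSub (⋀[ℂ]^1 (Module.Dual ℂ n)) W) :
    ω = ∑ i, ι ℂ ((Module.finBasis ℂ n).coord i) ⊗ₜ[ℂ]
      evalLeft (evalOne (Module.finBasis ℂ n i)) ω := by
  refine tensorSub_induction (q := fun ω => ω = ∑ i, ι ℂ ((Module.finBasis ℂ n).coord i) ⊗ₜ[ℂ]
      evalLeft (evalOne (Module.finBasis ℂ n i)) ω) (fun a ha w => ?_) (fun u v hu hv => ?_) hω
  · obtain ⟨f, rfl⟩ := exists_ι_eq_of_mem ha
    simp only [evalLeft_tmul, evalOne_ι]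
    exact ι_tmul_eq_sum f w
  · conv_lhs => rw [hu, hv]
    rw [← Finset.sum_add_distrib]
    exact Finset.sum_congr rfl fun i _ => by rw [map_add, TensorProduct.tmul_add]

lemma mem_flatConnections_iff {ω : ExteriorAlgebra ℂ (Module.Dual ℂ n) ⊗[ℂ] 𝔤} :
    ω ∈ (cochainAlgebra n).flatConnections 𝔤 ↔ ω ∈ tensorSub (⋀[ℂ]^1 (Module.Dual ℂ n)) 𝔤 ∧
      (ceD n).rTensor 𝔤 ω + (1 / 2 : ℂ) • extBracket n 𝔤 ω ω = 0 := Iff.rfl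

lemma evalLeft_evalOne_lie (x y : n) {ω : ExteriorAlgebra ℂ (Module.Dual ℂ n) ⊗[ℂ] 𝔤}
    (hω : ω ∈ (cochainAlgebra n).flatConnections 𝔤) :
    evalLeft (evalOne ⁅x, y⁆) ω = ⁅evalLeft (evalOne x) ω, evalLeft (evalOne y) ω⁆ := by
  rw [mem_flatConnections_iff] at hω
  have h := congrArg (evalLeft (evalTwo x y)) hω.2
  rw [map_add, map_smul, map_zero, evalLeft_evalTwo_ceD x y hω.1,
    evalLeft_evalTwo_bracket x y hω.1 hω.1,
    ← lie_skew (evalLeft (evalOne y) ω) (evalLeft (evalOne x) ω)] at h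
  rw [← sub_eq_zero, ← neg_eq_zero, ← h]
  module

/-- The homomorphism `𝔫 → 𝔤` that corresponds to a flat connection. -/
def flatHom {ω : ExteriorAlgebra ℂ (Module.Dual ℂ n) ⊗[ℂ] 𝔤}
    (hω : ω ∈ (cochainAlgebra n).flatConnections 𝔤) : n →ₗ⁅ℂ⁆ 𝔤 where
  toFun x := evalLeft (evalOne x) ω
  map_add' x y := by rw [evalOne_add, evalLeft_add]
  map_smul' c x := by rw [evalOne_smul, evalLeft_smul, RingHom.id_apply]
  map_lie' {x y} := evalLeft_evalOne_lie x y hω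

lemma essRankOne_subset_flatConnections (A : CDGA) : A.essRankOne 𝔤 ⊆ A.flatConnections 𝔤 := by
  rintro _ ⟨η, hη, g, rfl⟩
  refine ⟨tmul_mem_tensorSub hη.1 g, ?_⟩
  rw [LinearMap.rTensor_tmul, show A.d η = 0 from hη.2, TensorProduct.zero_tmul, zero_add,
    CDGA.bracket_tmul, lie_self, TensorProduct.tmul_zero, smul_zero]

theorem flatConnections_eq_essRankOne [LieRing.IsNilpotent n]
    {𝔤 : LieSubalgebra ℂ (Matrix (Fin 2) (Fin 2) ℂ)} (h𝔤 : ∀ a ∈ 𝔤, a.trace = 0) :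
    (cochainAlgebra n).flatConnections 𝔤 = (cochainAlgebra n).essRankOne 𝔤 := by
  refine Set.Subset.antisymm (fun (ω : ExteriorAlgebra ℂ (Module.Dual ℂ n) ⊗[ℂ] 𝔤) hω => ?_)
    (essRankOne_subset_flatConnections _)
  obtain ⟨η, z, hηz⟩ := exists_eq_smul_of_isNilpotent h𝔤 (flatHom hω)
  have hω' : ω = ι ℂ η ⊗ₜ[ℂ] z := by
    rw [ι_tmul_eq_sum, eq_sum_ι_coord_tmul_evalLeft hω.1]
    exact Finset.sum_congr rfl fun i _ => congrArg _ (hηz _)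
  -- For `z = 0` the functional `η` is unconstrained and need not be closed, so the zero cocycle
  -- takes its place. Otherwise `η` kills brackets because the multiples of `z` commute.
  by_cases hz : z = 0
  · refine ⟨0, Submodule.zero_mem _, 0, ?_⟩
    rw [hω', hz, TensorProduct.tmul_zero, TensorProduct.tmul_zero]
    rfl
  · refine ⟨ι ℂ η, ι_mem_Z1_iff.mpr fun x y => ?_, z, hω'⟩
    have h := (flatHom hω).map_lie x y
    rw [hηz, hηz, hηz, smul_lie, lie_smul, lie_self, smul_zero, smul_zero] at h
    exact (smul_eq_zero.mp h).resolve_right hz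

end FlatConnections

/-! ### Cohomology of the twisted complexes and resonance. -/

section Aomoto

open ExteriorAlgebra

lemma mem_resonance_one_iff (A : CDGA) {𝔤 V : Type*} [LieRing 𝔤] [LieAlgebra ℂ 𝔤] [AddCommGroup V]
    [Module ℂ V] (θ : 𝔤 →ₗ⁅ℂ⁆ Module.End ℂ V) (k : ℕ) (ω : A.carrier ⊗[ℂ] 𝔤) :
    ω ∈ A.resonance θ k 1 ↔ ω ∈ A.flatConnections 𝔤 ∧
      ¬ A.aomotoCocycles θ ω k ≤ A.aomotoCoboundaries θ ω k := by
  refine and_congr_right fun _ => ?_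
  rw [Nat.cast_one, Cardinal.one_le_iff_ne_zero, ne_eq, rank_zero_iff,
    Submodule.Quotient.subsingleton_iff, Submodule.submoduleOf_eq_top]

variable {n : Type*} [LieRing n] [LieAlgebra ℂ n]
variable {V : Type*} [AddCommGroup V] [Module ℂ V]

lemma rTensor_contr_mem {k : ℕ} (x : n) {t : ExteriorAlgebra ℂ (Module.Dual ℂ n) ⊗[ℂ] V}
    (ht : t ∈ tensorSub (⋀[ℂ]^k (Module.Dual ℂ n)) V) :
    (contr x).rTensor V t ∈ tensorSub (extPred n k) V := by
  refine tensorSub_induction (q := fun t => (contr x).rTensor V t ∈ tensorSub (extPred n k) V)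
    (fun a ha v => tmul_mem_tensorSub (contr_mem x ha) v) (fun u v hu hv => ?_) ht
  rw [map_add]
  exact Submodule.add_mem _ hu hv

variable [Module.Finite ℂ n]

/-- The differential `α ⊗ v ↦ dα ⊗ v + f α ⊗ T v` of `⋀ 𝔫* ⊗ V`. -/
def extCov (f : Module.Dual ℂ n) (T : Module.End ℂ V) :
    ExteriorAlgebra ℂ (Module.Dual ℂ n) ⊗[ℂ] V →ₗ[ℂ] ExteriorAlgebra ℂ (Module.Dual ℂ n) ⊗[ℂ] V :=
  (ceD n).rTensor V + TensorProduct.map (LinearMap.mulLeft ℂ (ι ℂ f)) T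

lemma extCov_tmul (f : Module.Dual ℂ n) (T : Module.End ℂ V)
    (a : ExteriorAlgebra ℂ (Module.Dual ℂ n)) (v : V) :
    extCov f T (a ⊗ₜ v) = ceD n a ⊗ₜ v + (ι ℂ f * a) ⊗ₜ T v := rfl

lemma mem_aomotoCocycles_iff {𝔤 : Type*} [LieRing 𝔤] [LieAlgebra ℂ 𝔤]
    (θ : 𝔤 →ₗ⁅ℂ⁆ Module.End ℂ V) (f : Module.Dual ℂ n) (g : 𝔤) (k : ℕ)
    {t : ExteriorAlgebra ℂ (Module.Dual ℂ n) ⊗[ℂ] V} :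
    t ∈ (cochainAlgebra n).aomotoCocycles θ (ι ℂ f ⊗ₜ[ℂ] g) k ↔
      t ∈ tensorSub (⋀[ℂ]^k (Module.Dual ℂ n)) V ∧ extCov f (θ g) t = 0 := Iff.rfl

lemma mem_aomotoCoboundaries_iff {𝔤 : Type*} [LieRing 𝔤] [LieAlgebra ℂ 𝔤]
    (θ : 𝔤 →ₗ⁅ℂ⁆ Module.End ℂ V) (f : Module.Dual ℂ n) (g : 𝔤) (k : ℕ)
    {t : ExteriorAlgebra ℂ (Module.Dual ℂ n) ⊗[ℂ] V} :
    t ∈ (cochainAlgebra n).aomotoCoboundaries θ (ι ℂ f ⊗ₜ[ℂ] g) k ↔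
      ∃ u ∈ tensorSub (extPred n k) V, extCov f (θ g) u = t := by
  cases k with
  | zero =>
    rw [extPred, tensorSub_bot]
    constructor
    · exact fun h => ⟨0, Submodule.zero_mem _, by rw [map_zero]; exact h.symm⟩
    · rintro ⟨u, hu, rfl⟩
      rw [(Submodule.mem_bot ℂ).mp hu, map_zero]
      exact Submodule.zero_mem _
  | succ k => exact Iff.rfl

section Acyclic

lemma extCov_extCov {f : Module.Dual ℂ n} (hf : ∀ x y : n, f ⁅x, y⁆ = 0) (T : Module.End ℂ V)
    (t : ExteriorAlgebra ℂ (Module.Dual ℂ n) ⊗[ℂ] V) : extCov f T (extCov f T t) = 0 := by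
  induction t using TensorProduct.induction_on with
  | zero => rw [map_zero, map_zero]
  | tmul a v =>
    rw [extCov_tmul, map_add, extCov_tmul, extCov_tmul, ceD_ceD, ceD_mul, ceD_ι,
      bracketDual_eq_zero_iff.mpr hf, bar_ι, ← mul_assoc, ι_sq_zero, zero_mul,
      TensorProduct.zero_tmul, TensorProduct.zero_tmul, zero_add, zero_add, add_zero, neg_mul,
      ← TensorProduct.add_tmul, add_neg_cancel, TensorProduct.zero_tmul]
  | add u v hu hv => rw [map_add, map_add, hu, hv, add_zero]

/-- The untwisted part gives `L_x` by Cartan's formula. The twisted part gives `f x • T = T`,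
because contraction with `x` and multiplication by `f` have anticommutator `f x`. -/
lemma extCov_homotopy {f : Module.Dual ℂ n} {x : n} (hfx : f x = 1) (T : Module.End ℂ V)
    (t : ExteriorAlgebra ℂ (Module.Dual ℂ n) ⊗[ℂ] V) :
    (contr x).rTensor V (extCov f T t) + extCov f T ((contr x).rTensor V t) =
      T.lTensor _ t + (lieDer x).rTensor V t := by
  induction t using TensorProduct.induction_on with
  | zero => simp only [map_zero, add_zero]
  | tmul a v =>
    simp only [extCov_tmul, LinearMap.rTensor_tmul, LinearMap.lTensor_tmul, map_add, contr_ι_mul,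
      hfx, one_smul, TensorProduct.sub_tmul, lieDer_apply, TensorProduct.add_tmul]
    abel
  | add u v hu hv =>
    rw [map_add, map_add, map_add, map_add, map_add, map_add, add_add_add_comm, hu, hv]
    abel

/-- An invertible coefficient endomorphism makes the twisted complex acyclic. -/
lemma exists_extCov_eq_of_isUnit [LieRing.IsNilpotent n] [Module.Finite ℂ V]
    {f : Module.Dual ℂ n} (hf : ∀ x y : n, f ⁅x, y⁆ = 0) (hf0 : f ≠ 0) {T : Module.End ℂ V}
    (hT : IsUnit T) {k : ℕ} {t : ExteriorAlgebra ℂ (Module.Dual ℂ n) ⊗[ℂ] V}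
    (ht : t ∈ tensorSub (⋀[ℂ]^k (Module.Dual ℂ n)) V) (hdt : extCov f T t = 0) :
    ∃ u ∈ tensorSub (extPred n k) V, extCov f T u = t := by
  obtain ⟨x, hfx⟩ : ∃ x, f x = 1 := by
    obtain ⟨x, hx⟩ := DFunLike.ne_iff.mp hf0
    exact ⟨(f x)⁻¹ • x, by rw [map_smul, smul_eq_mul]; exact inv_mul_cancel₀ hx⟩
  set H : Module.End ℂ (ExteriorAlgebra ℂ (Module.Dual ℂ n) ⊗[ℂ] V) :=
    T.lTensor _ + (lieDer x).rTensor V with hH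
  have hHt : ∀ t, H t = (contr x).rTensor V (extCov f T t) +
      extCov f T ((contr x).rTensor V t) := fun t => (extCov_homotopy hfx T t).symm
  -- The two summands act on different tensor factors and so commute; a unit plus a commuting
  -- nilpotent is a unit.
  have hunit : IsUnit H := by
    refine IsNilpotent.isUnit_add_left_of_commute ?_ (hT.map (Module.End.lTensorAlgHom ℂ V _)) ?_
    · exact (isNilpotent_lieDer x).map (Module.End.rTensorAlgHom ℂ _ V)
    · change (lieDer x).rTensor V ∘ₗ T.lTensor _ = T.lTensor _ ∘ₗ (lieDer x).rTensor V
      rw [LinearMap.rTensor_comp_lTensor, LinearMap.lTensor_comp_rTensor]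
  have hinj : Function.Injective H := ((Module.End.isUnit_iff _).mp hunit).injective
  set P := tensorSub (⋀[ℂ]^k (Module.Dual ℂ n)) V with hP
  have hmap : P.map H ≤ P := by
    rintro _ ⟨u, hu, rfl⟩
    refine tensorSub_induction (q := fun u => H u ∈ P) (fun a ha v => ?_) (fun u v hu hv => ?_) hu
    · exact Submodule.add_mem _ (tmul_mem_tensorSub ha _) (tmul_mem_tensorSub (lieDer_mem x ha) v)
    · rw [map_add]
      exact Submodule.add_mem _ hu hv
  have hmap' : P.map H = P :=
    Submodule.eq_of_le_of_finrank_eq hmap ((LinearEquiv.ofInjectiveEndo H hinj).finrank_map_eq P)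
  obtain ⟨w, hw, rfl⟩ : t ∈ P.map H := hmap'.symm ▸ ht
  -- `H` commutes with the differential and is injective, so the preimage `w` of the cocycle `t` is
  -- a cocycle, and the homotopy then gives `t = d_ω (i_x w)`.
  have hdw : extCov f T w = 0 := by
    refine hinj ?_
    rw [map_zero, ← hdt, hHt, hHt, extCov_extCov hf, map_zero, zero_add, map_add,
      extCov_extCov hf, add_zero]
  refine ⟨(contr x).rTensor V w, rTensor_contr_mem x hw, ?_⟩
  rw [hHt, hdw, map_zero, zero_add]

end Acyclic

section NonAcyclic

/-- Apply a linear functional to the second factor of a tensor product. -/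
def evalRight {M : Type*} [AddCommGroup M] [Module ℂ M] (φ : Module.Dual ℂ V) : M ⊗[ℂ] V →ₗ[ℂ] M :=
  (TensorProduct.rid ℂ M).toLinearMap.comp (φ.lTensor M)

lemma evalRight_tmul {M : Type*} [AddCommGroup M] [Module ℂ M] (φ : Module.Dual ℂ V) (a : M)
    (v : V) : evalRight φ (a ⊗ₜ[ℂ] v) = φ v • a := rfl

lemma evalRight_zero {M : Type*} [AddCommGroup M] [Module ℂ M] (t : M ⊗[ℂ] V) :
    evalRight 0 t = 0 := by
  rw [evalRight, LinearMap.lTensor_zero, LinearMap.comp_zero, LinearMap.zero_apply]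

lemma evalRight_mem {M : Type*} [AddCommGroup M] [Module ℂ M] {p : Submodule ℂ M}
    (φ : Module.Dual ℂ V) {t : M ⊗[ℂ] V} (ht : t ∈ tensorSub p V) : evalRight φ t ∈ p := by
  refine tensorSub_induction (q := fun t => evalRight φ t ∈ p)
    (fun a ha v => p.smul_mem _ ha) (fun u v hu hv => ?_) ht
  rw [map_add]
  exact p.add_mem hu hv

/-- This turns a twisted coboundary into an untwisted one plus a multiple of `f`. The multiple
disappears when `φ` vanishes on the range of `T`, and always lies in the ideal of `ker f`. -/
lemma evalRight_extCov (f : Module.Dual ℂ n) (T : Module.End ℂ V) (φ : Module.Dual ℂ V)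
    (t : ExteriorAlgebra ℂ (Module.Dual ℂ n) ⊗[ℂ] V) :
    evalRight φ (extCov f T t) = ceD n (evalRight φ t) + ι ℂ f * evalRight (φ ∘ₗ T) t := by
  induction t using TensorProduct.induction_on with
  | zero => simp only [map_zero, mul_zero, add_zero]
  | tmul a v =>
    rw [extCov_tmul, map_add, evalRight_tmul, evalRight_tmul, evalRight_tmul, evalRight_tmul,
      map_smul, mul_smul_comm, LinearMap.comp_apply]
  | add u v hu hv =>
    rw [map_add, map_add, map_add, map_add, map_add, hu, hv, mul_add]
    abel

lemma ceD_eq_zero_of_mem_relCocycles_top {k : ℕ} {c : ExteriorAlgebra ℂ (Module.Dual ℂ n)}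
    (hc : c ∈ relCocycles (⊤ : Submodule ℂ n) k) : ceD n c = 0 := by
  have h : ceD n c ∈ annIdeal (⊤ : Submodule ℂ n) := hc.2
  rwa [annIdeal_top, Submodule.mem_bot] at h

/-- A non-invertible coefficient endomorphism gives nonzero twisted cohomology in all degrees up to
the dimension. -/
lemma exists_extCov_ne_of_det_eq_zero [LieRing.IsNilpotent n] [Module.Finite ℂ V] [Nontrivial V]
    {f : Module.Dual ℂ n} (hf : ∀ x y : n, f ⁅x, y⁆ = 0) {T : Module.End ℂ V}
    (hT : LinearMap.det T = 0) {k : ℕ} (hk : k ≤ Module.finrank ℂ n) :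
    ∃ t ∈ tensorSub (⋀[ℂ]^k (Module.Dual ℂ n)) V, extCov f T t = 0 ∧
      ∀ u ∈ tensorSub (extPred n k) V, extCov f T u ≠ t := by
  by_cases hf0 : f = 0
  -- With `f = 0` there is no twist, and any nonzero class of `𝔫` tensored with any nonzero vector
  -- will do.
  · subst hf0
    obtain ⟨v, hv⟩ := exists_ne (0 : V)
    obtain ⟨φ, hφ, -⟩ := Submodule.exists_le_ker_of_notMem (p := (⊥ : Submodule ℂ V)) hv
    obtain ⟨c, hc, hcB⟩ := SetLike.not_le_iff_exists.mp
      (not_relCocycles_le_relCoboundaries (⊤ : LieIdeal ℂ n) (k := k) (by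
        rw [show Module.finrank ℂ (⊤ : LieIdeal ℂ n) = Module.finrank ℂ n from finrank_top ℂ n]
        exact hk))
    refine ⟨c ⊗ₜ v, tmul_mem_tensorSub hc.1 v, ?_, fun u hu h => hcB ?_⟩
    · rw [extCov_tmul, ceD_eq_zero_of_mem_relCocycles_top hc, map_zero, zero_mul,
        TensorProduct.zero_tmul, TensorProduct.zero_tmul, add_zero]
    · have h' := evalRight_extCov 0 T φ u
      rw [h, evalRight_tmul, map_zero, zero_mul, add_zero] at h'
      rw [← inv_smul_smul₀ hφ c, h']
      exact Submodule.smul_mem _ _ (Submodule.mem_sup_left ⟨_, evalRight_mem φ hu, rfl⟩)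
  · obtain ⟨x, hfx⟩ : ∃ x, f x = 1 := by
      obtain ⟨x, hx⟩ := DFunLike.ne_iff.mp hf0
      exact ⟨(f x)⁻¹ • x, by rw [map_smul, smul_eq_mul]; exact inv_mul_cancel₀ hx⟩
    let q : LieIdeal ℂ n :=
      { toSubmodule := ⊤ ⊓ LinearMap.ker f
        lie_mem := fun {x y} _ => ⟨Submodule.mem_top, hf x y⟩ }
    have hqf : Module.finrank ℂ q + 1 = Module.finrank ℂ n :=
      (finrank_inf_ker (p := (⊤ : Submodule ℂ n)) Submodule.mem_top hfx).trans (finrank_top ℂ n)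
    have hfq : f ∈ q.toSubmodule.dualAnnihilator := by
      rw [Submodule.mem_dualAnnihilator]
      exact fun y hy => hy.2
    have hlie : ∀ x : n, ∀ y ∈ (⊤ : Submodule ℂ n), ⁅x, y⁆ ∈ q.toSubmodule :=
      fun x y _ => ⟨Submodule.mem_top, hf x y⟩
    have hsup := le_inf_ker_sup_span (p := (⊤ : Submodule ℂ n)) (Submodule.mem_top) hfx
    rcases hk.lt_or_eq with hk | hk
    -- Below the top degree, choose `v ∈ ker T` and a cocycle `c` of `𝔫` that is not a coboundary
    -- even after restriction to `q = ker f`: an application of `φ` to a twisted coboundary leaves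
    -- an uncontrolled multiple of `f`, which vanishes on `q`.
    · obtain ⟨v, hvT, hv⟩ := (LinearMap.ker T).exists_mem_ne_zero_of_ne_bot
        (LinearMap.bot_lt_ker_of_det_eq_zero hT).ne'
      obtain ⟨φ, hφ, -⟩ := Submodule.exists_le_ker_of_notMem (p := (⊥ : Submodule ℂ V)) hv
      obtain ⟨c, hc, hcB⟩ := exists_relCocycle_lift (q := q.toSubmodule) le_top hsup hlie hfq
        Submodule.mem_top hfx (not_relCocycles_le_relCoboundaries q (k := k) (by omega))
      refine ⟨c ⊗ₜ v, tmul_mem_tensorSub hc.1 v, ?_, fun u hu h => hcB ?_⟩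
      · rw [extCov_tmul, ceD_eq_zero_of_mem_relCocycles_top hc, show T v = 0 from hvT,
          TensorProduct.zero_tmul, TensorProduct.tmul_zero, add_zero]
      · have h' := evalRight_extCov f T φ u
        rw [h, evalRight_tmul] at h'
        rw [← inv_smul_smul₀ hφ c, h']
        exact Submodule.smul_mem _ _ (Submodule.add_mem_sup ⟨_, evalRight_mem φ hu, rfl⟩
          (ι_mul_mem_annIdeal hfq _))
    -- In the top degree every cochain restricts to zero on `q`. Here the class is a multiple of
    -- `f`, so `f ∧ f = 0` makes the twist vanish on it for any `v`, and `v` can be taken outside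
    -- the range of `T`.
    · obtain ⟨v, -, hv⟩ := SetLike.exists_of_lt (LinearMap.range_lt_top_of_det_eq_zero hT)
      obtain ⟨φ, hφ, hφT⟩ := Submodule.exists_le_ker_of_notMem hv
      have hφT' : φ ∘ₗ T = 0 := LinearMap.ext fun w => hφT ⟨w, rfl⟩
      obtain ⟨m, rfl⟩ : ∃ m, k = m + 1 := ⟨k - 1, by omega⟩
      obtain ⟨c, hc, hcB⟩ := exists_ι_mul_notMem_relCoboundaries (q := q.toSubmodule) le_top hsup
        hlie hfq Submodule.mem_top hfx (not_relCocycles_le_relCoboundaries q (k := m) (by omega))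
      refine ⟨(ι ℂ f * c) ⊗ₜ v, tmul_mem_tensorSub hc.1 v, ?_, fun u hu h => hcB ?_⟩
      · rw [extCov_tmul, ceD_eq_zero_of_mem_relCocycles_top hc, ← mul_assoc, ι_sq_zero, zero_mul,
          TensorProduct.zero_tmul, TensorProduct.zero_tmul, add_zero]
      · have h' := evalRight_extCov f T φ u
        rw [h, evalRight_tmul, hφT', evalRight_zero, mul_zero, add_zero] at h'
        rw [← inv_smul_smul₀ hφ (ι ℂ f * c), h']
        exact Submodule.smul_mem _ _ (Submodule.mem_sup_left ⟨_, evalRight_mem φ hu, rfl⟩)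

end NonAcyclic

section Resonance

variable {𝔤 : LieSubalgebra ℂ (Matrix (Fin 2) (Fin 2) ℂ)}
  (θ : 𝔤 →ₗ⁅ℂ⁆ Module.End ℂ V)

lemma resonance_eq_empty {k : ℕ} (hk : Module.finrank ℂ n < k) :
    (cochainAlgebra n).resonance θ k 1 = ∅ := by
  refine Set.eq_empty_iff_forall_notMem.mpr fun ω hω => ?_
  rw [mem_resonance_one_iff] at hω
  refine hω.2 fun (t : ExteriorAlgebra ℂ (Module.Dual ℂ n) ⊗[ℂ] V) ht => ?_
  have h : t ∈ tensorSub (⋀[ℂ]^k (Module.Dual ℂ n)) V := ht.1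
  rw [exteriorPower_eq_bot hk, tensorSub_bot, Submodule.mem_bot] at h
  rw [h]
  exact Submodule.zero_mem _

lemma zero_mem_detLocus [Module.Finite ℂ V] [Nontrivial V] :
    (0 : (cochainAlgebra n).carrier ⊗[ℂ] 𝔤) ∈ (cochainAlgebra n).detLocus θ :=
  ⟨0, Submodule.zero_mem _, 0, by rw [map_zero, LinearMap.det_zero''],
    (TensorProduct.zero_tmul _ _).symm⟩

theorem resonance_eq_detLocus [LieRing.IsNilpotent n] [Module.Finite ℂ V] [Nontrivial V] (h𝔤 : ∀ a ∈ 𝔤, a.trace = 0)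
    {k : ℕ} (hk : k ≤ Module.finrank ℂ n) :
    (cochainAlgebra n).resonance θ k 1 = (cochainAlgebra n).detLocus θ := by
  ext ω
  rw [mem_resonance_one_iff, flatConnections_eq_essRankOne h𝔤]
  constructor
  · rintro ⟨⟨η, hη, g, rfl⟩, hω⟩
    by_contra hdet
    obtain ⟨f, rfl⟩ := exists_ι_eq_of_mem hη.1
    have hg : LinearMap.det (θ g) ≠ 0 := fun h => hdet ⟨ι ℂ f, hη, g, h, rfl⟩
    -- The zero connection also equals `0 ⊗ 0`, so it belongs to `Π` even when it is presented as `0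
    -- ⊗ g` with `θ g` invertible.
    have hf0 : f ≠ 0 := by
      rintro rfl
      have h0 : ι ℂ (0 : Module.Dual ℂ n) ⊗ₜ[ℂ] g = 0 := by rw [map_zero, TensorProduct.zero_tmul]
      exact hdet (h0 ▸ zero_mem_detLocus θ)
    refine hω fun (t : ExteriorAlgebra ℂ (Module.Dual ℂ n) ⊗[ℂ] V) ht => ?_
    exact (mem_aomotoCoboundaries_iff θ f g k).mpr (exists_extCov_eq_of_isUnit
      (ι_mem_Z1_iff.mp hη) hf0 ((LinearMap.isUnit_iff_isUnit_det _).mpr hg.isUnit) ht.1 ht.2)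
  · rintro ⟨η, hη, g, hg, rfl⟩
    obtain ⟨f, rfl⟩ := exists_ι_eq_of_mem hη.1
    refine ⟨⟨ι ℂ f, hη, g, rfl⟩, fun hle => ?_⟩
    obtain ⟨t, ht, hdt, hne⟩ := exists_extCov_ne_of_det_eq_zero (ι_mem_Z1_iff.mp hη) hg hk
    obtain ⟨u, hu, hut⟩ := (mem_aomotoCoboundaries_iff θ f g k).mp
      (hle ((mem_aomotoCocycles_iff θ f g k).mpr ⟨ht, hdt⟩))
    exact hne u hu hut

end Resonance

end Aomoto

end FlatConn

end

/-- Finite dimension of `𝔫` is part of the conclusion because the cochain algebra is defined only in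
its presence. The two choices of `𝔤` enter through the tracelessness of their elements. -/
theorem theorem4p12 {π : Type*} [Group π] [Group.FG π] [Group.IsNilpotent π]
    (𝔤 : LieSubalgebra ℂ (Matrix (Fin 2) (Fin 2) ℂ))
    (h𝔤 : 𝔤 = LieAlgebra.SpecialLinear.sl (Fin 2) ℂ ∨ 𝔤 = FlatConn.sol2)
    {V : Type*} [AddCommGroup V] [Module ℂ V] [Module.Finite ℂ V] [Nontrivial V]
    (θ : 𝔤 →ₗ⁅ℂ⁆ Module.End ℂ V) :
    ∃ _ : Module.Finite ℂ (FlatConn.MalcevLieAlgebra π),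
      (FlatConn.cochainAlgebra (FlatConn.MalcevLieAlgebra π)).flatConnections 𝔤 =
          (FlatConn.cochainAlgebra (FlatConn.MalcevLieAlgebra π)).essRankOne 𝔤 ∧
        ∀ k : ℕ,
          (Module.finrank ℂ (FlatConn.MalcevLieAlgebra π) < k →
            (FlatConn.cochainAlgebra (FlatConn.MalcevLieAlgebra π)).resonance θ k 1 = ∅) ∧
          (k ≤ Module.finrank ℂ (FlatConn.MalcevLieAlgebra π) →
            (FlatConn.cochainAlgebra (FlatConn.MalcevLieAlgebra π)).resonance θ k 1 =
                (FlatConn.cochainAlgebra (FlatConn.MalcevLieAlgebra π)).detLocus θ ∧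
              ((FlatConn.cochainAlgebra (FlatConn.MalcevLieAlgebra π)).detLocus θ).Nonempty) := by
  have := FlatConn.MalcevLieAlgebra.finite π
  have := FlatConn.MalcevLieAlgebra.isNilpotent π
  have htrace : ∀ a ∈ 𝔤, a.trace = 0 := by
    rcases h𝔤 with rfl | rfl
    · exact fun a ha => ha
    · exact fun a ha => ha.1
  exact ⟨inferInstance, FlatConn.flatConnections_eq_essRankOne htrace, fun k =>
    ⟨fun hk => FlatConn.resonance_eq_empty θ hk, fun hk =>
      ⟨FlatConn.resonance_eq_detLocus θ htrace hk, 0, FlatConn.zero_mem_detLocus θ⟩⟩⟩
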